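/- Let $\epsilon\in(0,1]$ and $\rho\in(0,1)$ be constants with $(1+\rho)\epsilon\le 1$. The algorithm DynELM with failure parameter $\delta^*$ maintains a $\rho$-approximate similar/dissimilar labelling of the edges of a dynamic undirected graph under Jaccard similarity $\sigma(u,v)=|N[u]\cap N[v]|/|N[u]\cup N[v]|$ of closed neighbourhoods, starting from the edgeless graph; each update inserts a new edge or deletes an existing edge. It works as follows. * *Labelling.* The $i$-th time that an edge $(u,v)$ is to be labelled, put $\delta_i=\delta^*/(i(i+1))$, $\Delta=\tfrac12\rho\epsilon$ and draw $L_i=\lceil \tfrac{2}{\Delta^2}\ln\tfrac{2}{\delta_i}\rceil$ independent samples: choose $u$ with probability $|N[u]|/(|N[u]|+|N[v]|)$ and $v$ otherwise, pick a uniformly random vertex $x$ of the closed neighbourhood of the chosen vertex, and set $X=1$ if $x\in N[u]\cap N[v]$, $X=0$ otherwise. With $\bar X$ the mean of the samples, label the edge similar if and only if $\bar X/(2-\bar X)\ge\epsilon$. * *Tracking.* When an edge $(u,v)$ is labelled, a distributed-tracking instance with participants $u,v$ and threshold $\tau(u,v)=\lfloor\tfrac12\rho\epsilon\max(d[u],d[v])\rfloor+1$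 is started, which matures, and causes the edge to be relabelled and the instance to be restarted, at the $\tau(u,v)$-th subsequent update of another edge incident on $u$ or $v$. The instance runs in rounds: a round with remaining threshold $\tau\le 8$ signals every increment; a round with $\tau>8$ has slack $\lfloor\tau/4\rfloor$, each participant signals after each slack-many of its increments, and at the second signal of the round the exact counters are collected and a new round is started with the remaining threshold. * *Data structures.* Each vertex has one counter shared by all its tracking instances, a balanced search tree of its neighbours, and a min-priority queue (also a balanced search tree) of the next checkpoints of its instances; the edge records are in one more balanced search tree. An update of $(u,w)$ increments the counters of $u$ and $w$, inserts and labels (or deletes) the edge with its instance, and then processes, first at $u$ and then at $w$, the top of the priority queue for as long as its checkpoint equals the counter. Running time is the number of elementary steps, where visiting a tree node, an arithmetic operation, an array access and drawing a uniform integer take $O(1)$ steps each. **Claim.** Set $\delta^*=1/n$. For all constants $A$ and $c$ there is a constant $K$, depending only on $\epsilon,\rho,A,c$, such that for every $n$ and every sequence of $M\le A\,n^{c}$ valid updates of a graph on a fixed set of $n$ vertices, every run of DynELM (whatever its random choices) halts, and its total update time is at most $M\cdot K\log^2 n$. That is, if $n$ is fixed over the update sequence and $M=O(n^c)$, the amortized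 update cost of DynELM is $O(\log^2 n)$. -/

import Mathlib

namespace DynELM

/-! ### Step-counted computations -/

/-- The outcome of a deterministic computation, with the number of elementary steps it took. -/
structure Timed (α : Type) where
  val : α
  time : ℕ

instance : Monad Timed where
  pure a := ⟨a, 0⟩
  bind x f := ⟨(f x.val).val, x.time + (f x.val).time⟩

/-- One elementary step (a bounded number of word operations and memory accesses). -/
def Timed.tick : Timed Unit := ⟨(), 1⟩

/-- A randomized computation: the distribution of its outcome. The outcome is `some (a, t)` if the
computation halts after `t` steps with the value `a`, and `none` if it faults or does not halt. -/
def Rand (α : Type) : Type := PMF (Option (α × ℕ))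

namespace Rand

/-- The distribution of the outcomes `some (value, number of steps)` or `none`. -/
def dist {α : Type} (p : Rand α) : PMF (Option (α × ℕ)) := p

noncomputable instance : Monad Rand where
  pure a := PMF.pure (some (a, 0))
  bind p f := PMF.bind (dist p) fun
    | none => PMF.pure none
    | some (a, t) => PMF.map (Option.map fun x => (x.1, t + x.2)) (dist (f a))

/-- Run a deterministic step-counted computation. -/
noncomputable def ofTimed {α : Type} (x : Timed α) : Rand α := PMF.pure (some (x.val, x.time))

/-- One elementary step. -/
noncomputable def tick : Rand Unit := PMF.pure (some ((), 1))

/-- The computation that faults or does not halt. -/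
noncomputable def fault {α : Type} : Rand α := PMF.pure none

/-- Draw an integer uniformly at random from `{0, …, k}`, in one step. -/
noncomputable def uniform (k : ℕ) : Rand (Fin (k + 1)) :=
  PMF.map (fun i => some (i, 1)) (PMF.uniformOfFintype (Fin (k + 1)))

end Rand

/-! ### Balanced binary search trees

AVL trees whose nodes store the height and the number of nodes of their subtree. Every operation
takes one step for each node that it visits (which covers the comparison and the rotation there). -/

inductive AVL (κ ν : Type) : Type where
  | nil : AVL κ ν
  | node (height size : ℕ) (l : AVL κ ν) (key : κ) (val : ν) (r : AVL κ ν) : AVL κ ν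

namespace AVL

variable {κ ν : Type}

def height : AVL κ ν → ℕ
  | nil => 0
  | node h _ _ _ _ _ => h

def size : AVL κ ν → ℕ
  | nil => 0
  | node _ s _ _ _ _ => s

def mk (l : AVL κ ν) (k : κ) (v : ν) (r : AVL κ ν) : AVL κ ν :=
  node (max l.height r.height + 1) (l.size + r.size + 1) l k v r

def rotateRight (l : AVL κ ν) (k : κ) (v : ν) (r : AVL κ ν) : AVL κ ν :=
  match l with
  | nil => mk nil k v r
  | node _ _ ll lk lv lr => mk ll lk lv (mk lr k v r)

def rotateLeft (l : AVL κ ν) (k : κ) (v : ν) (r : AVL κ ν) : AVL κ ν :=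
  match r with
  | nil => mk l k v nil
  | node _ _ rl rk rv rr => mk (mk l k v rl) rk rv rr

/-- The node with the given parts, rebalanced if the heights of `l` and `r` differ by two. -/
def balance (l : AVL κ ν) (k : κ) (v : ν) (r : AVL κ ν) : AVL κ ν :=
  if r.height + 1 < l.height then
    match l with
    | nil => mk l k v r
    | node _ _ ll lk lv lr =>
      if lr.height ≤ ll.height then rotateRight l k v r
      else rotateRight (rotateLeft ll lk lv lr) k v r
  else if l.height + 1 < r.height then
    match r with
    | nil => mk l k v r
    | node _ _ rl rk rv rr =>
      if rl.height ≤ rr.height then rotateLeft l k v r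
      else rotateLeft l k v (rotateRight rl rk rv rr)
  else mk l k v r

/-- The `i`-th smallest key, counted from `0`. -/
def select (i : ℕ) : AVL κ ν → Timed (Option κ)
  | nil => do Timed.tick; return none
  | node _ _ l k _ r => do
    Timed.tick
    if i < l.size then select i l
    else if i = l.size then return some k
    else select (i - l.size - 1) r

/-- The smallest key. -/
def min? : AVL κ ν → Timed (Option κ)
  | nil => do Timed.tick; return none
  | node _ _ nil k _ _ => do Timed.tick; return some k
  | node _ _ (node h s ll lk lv lr) _ _ _ => do
    Timed.tick
    min? (node h s ll lk lv lr)

/-- Split the nonempty tree with left part `l`, root `(k, v)` and right part `r` into its first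
binding and the tree of the others. -/
def splitMin (l : AVL κ ν) (k : κ) (v : ν) (r : AVL κ ν) : Timed ((κ × ν) × AVL κ ν) :=
  match l with
  | nil => do Timed.tick; return ((k, v), r)
  | node _ _ ll lk lv lr => do
    Timed.tick
    let p ← splitMin ll lk lv lr
    return (p.1, balance p.2 k v r)

/-- Concatenate two trees, all keys of the first being smaller than those of the second. -/
def glue (l r : AVL κ ν) : Timed (AVL κ ν) :=
  match r with
  | nil => do Timed.tick; return l
  | node _ _ rl rk rv rr => do
    let p ← splitMin rl rk rv rr
    return balance l p.1.1 p.1.2 p.2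

variable [LinearOrder κ]

/-- The value stored under the key `x`. -/
def find? (x : κ) : AVL κ ν → Timed (Option ν)
  | nil => do Timed.tick; return none
  | node _ _ l k v r => do
    Timed.tick
    if x < k then find? x l
    else if k < x then find? x r
    else return some v

/-- Store the value `y` under the key `x`, replacing the old value if there is one. -/
def insert (x : κ) (y : ν) : AVL κ ν → Timed (AVL κ ν)
  | nil => do Timed.tick; return mk nil x y nil
  | node h s l k v r => do
    Timed.tick
    if x < k then
      let l' ← insert x y l
      return balance l' k v r
    else if k < x then
      let r' ← insert x y r
      return balance l k v r'
    else return node h s l x y r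

/-- Delete the key `x`. -/
def erase (x : κ) : AVL κ ν → Timed (AVL κ ν)
  | nil => do Timed.tick; return nil
  | node _ _ l k v r => do
    Timed.tick
    if x < k then
      let l' ← erase x l
      return balance l' k v r
    else if k < x then
      let r' ← erase x r
      return balance l k v r'
    else glue l r

end AVL

/-! ### The data structure -/

/-- What a participant `u` stores for the tracking instance of an edge `(u, v)`: the value of the
shared counter of `u` when the current round started, and the next (shifted) checkpoint. -/
structure Entry where
  sbar : ℕ
  checkpoint : ℕ

/-- What the coordinator of an edge stores: the label (`true` for similar), the threshold and the
slack of the current round, and the number of signals received in the current round. -/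
structure Coord where
  label : Bool
  tau : ℕ
  slack : ℕ
  signals : ℕ

/-- What a vertex `u` stores: its shared counter, the search tree of its neighbours, and the
priority queue `dtHeap` of the tracking instances of its edges, ordered by their checkpoints. -/
structure VertexData (n : ℕ) where
  counter : ℕ
  nbrs : AVL (Fin n) Entry
  dtHeap : AVL (ℕ ×ₗ Fin n) Unit

/-- The memory: an array of vertices, the search tree of the coordinators of the edges, and the
number of invocations of the labelling strategy so far. -/
structure State (n : ℕ) where
  vert : Fin n → VertexData n
  coords : AVL (Fin n ×ₗ Fin n) Coord
  invocations : ℕ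

/-- The data structure of the graph on `n` vertices without edges. -/
def State.empty (n : ℕ) : State n where
  vert _ := ⟨0, .nil, .nil⟩
  coords := .nil
  invocations := 0

/-- An edge `(u, v)` is addressed by its ordered pair of endpoints. -/
def edgeKey {n : ℕ} (u v : Fin n) : Fin n ×ₗ Fin n := toLex (min u v, max u v)

def State.degree {n : ℕ} (st : State n) (u : Fin n) : ℕ := (st.vert u).nbrs.size

def State.setVert {n : ℕ} (st : State n) (u : Fin n) (d : VertexData n) : State n :=
  { st with vert := Function.update st.vert u d }

section Algorithm

variable {n : ℕ}

/-! ### The sampling estimator and the labelling strategy -/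

/-- Test whether `w` is in the closed neighbourhood `N[u]`. -/
noncomputable def memClosedNbhd (st : State n) (w u : Fin n) : Rand Bool := do
  Rand.tick
  if w = u then return true
  else
    let e ← Rand.ofTimed ((st.vert u).nbrs.find? w)
    return e.isSome

/-- Pick a vertex uniformly at random from the closed neighbourhood `N[u]`. -/
noncomputable def pickClosedNbhd (st : State n) (u : Fin n) : Rand (Fin n) := do
  let i ← Rand.uniform (st.degree u)
  if i.val = 0 then return u
  else
    let w ← Rand.ofTimed ((st.vert u).nbrs.select (i.val - 1))
    match w with
    | some w => return w
    | none => Rand.fault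

/-- One sample of the estimator for the edge `(u, v)`. The coin `z` selects `u` with probability
`|N[u]| / (|N[u]| + |N[v]|)`, where `|N[u]| + |N[v]| = |N[u] ∩ N[v]| + |N[u] ∪ N[v]|`. -/
noncomputable def sample (st : State n) (u v : Fin n) : Rand Bool := do
  let z ← Rand.uniform (st.degree u + st.degree v + 1)
  let w ← pickClosedNbhd st (if z.val < st.degree u + 1 then u else v)
  let a ← memClosedNbhd st w u
  let b ← memClosedNbhd st w v
  return (a && b)

/-- The number of successes among `L` independent samples. -/
noncomputable def countSamples (st : State n) (u v : Fin n) : ℕ → Rand ℕ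
  | 0 => do Rand.tick; return 0
  | L + 1 => do
    Rand.tick
    let x ← sample st u v
    let k ← countSamples st u v L
    return (if x then k + 1 else k)

/-- The sample size `(2 / Δ²) ln (2 / δ)`, rounded up. -/
noncomputable def sampleSize (Δ δ : ℝ) : ℕ := ⌈2 / Δ ^ 2 * Real.log (2 / δ)⌉₊

/-- The failure probability `δ* / (i (i + 1))` allotted to the `i`-th invocation. -/
noncomputable def invocationDelta (δstar : ℝ) (i : ℕ) : ℝ := δstar / ((i : ℝ) * ((i : ℝ) + 1))

/-- The next invocation of the `(ρε/2, δ)`-strategy, on the edge `(u, v)`: the label is similar if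
and only if the estimate `X̄ / (2 - X̄)` of the Jaccard similarity is at least `ε`. -/
noncomputable def strategy (ε ρ δstar : ℝ) (st : State n) (u v : Fin n) :
    Rand (State n × Bool) := do
  Rand.tick
  let i := st.invocations + 1
  let L := sampleSize (1 / 2 * ρ * ε) (invocationDelta δstar i)
  let k ← countSamples st u v L
  let X : ℝ := (k : ℝ) / (L : ℝ)
  return ({ st with invocations := i }, @decide (ε ≤ X / (2 - X)) (Classical.dec _))

/-! ### Distributed tracking, with two participants per edge -/

/-- The tracking threshold `⌊ρε/2 · max (d[u], d[v])⌋ + 1` of a new instance. -/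
noncomputable def threshold (ε ρ : ℝ) (st : State n) (u v : Fin n) : ℕ :=
  ⌊1 / 2 * ρ * ε * (max (st.degree u) (st.degree v) : ℕ)⌋₊ + 1

/-- The slack of a round with threshold `τ`: with `h = 2` participants it is `⌊τ / (2h)⌋` if
`τ > 4h`; for `τ ≤ 4h` each increment is signalled. -/
def slackOf (τ : ℕ) : ℕ := if τ ≤ 8 then 1 else τ / 4

/-- Set the entry of the participant `u` for the edge `(u, v)` and push it on `DtHeap(u)`. -/
noncomputable def pushEntry (st : State n) (u v : Fin n) (e : Entry) : Rand (State n) := do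
  Rand.tick
  let nb ← Rand.ofTimed ((st.vert u).nbrs.insert v e)
  let hp ← Rand.ofTimed ((st.vert u).dtHeap.insert (toLex (e.checkpoint, v)) ())
  return st.setVert u { st.vert u with nbrs := nb, dtHeap := hp }

/-- Remove the entry for the edge `(u, v)` from `DtHeap(u)`. -/
noncomputable def popEntry (st : State n) (u v : Fin n) : Rand (State n × Entry) := do
  Rand.tick
  let e ← Rand.ofTimed ((st.vert u).nbrs.find? v)
  match e with
  | none => Rand.fault
  | some e =>
    let hp ← Rand.ofTimed ((st.vert u).dtHeap.erase (toLex (e.checkpoint, v)))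
    return (st.setVert u { st.vert u with dtHeap := hp }, e)

/-- Write the coordinator of the edge `(u, v)`. -/
noncomputable def setCoord (st : State n) (u v : Fin n) (c : Coord) : Rand (State n) := do
  Rand.tick
  let cs ← Rand.ofTimed (st.coords.insert (edgeKey u v) c)
  return { st with coords := cs }

/-- Start a round with threshold `τ` of the instance of the edge `(u, v)`, which has no entry in the
heaps of `u` and `v`. -/
noncomputable def startRound (st : State n) (u v : Fin n) (label : Bool) (τ : ℕ) :
    Rand (State n) := do
  let st ← setCoord st u v ⟨label, τ, slackOf τ, 0⟩
  let st ← pushEntry st u v ⟨(st.vert u).counter, (st.vert u).counter + slackOf τ⟩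
  pushEntry st v u ⟨(st.vert v).counter, (st.vert v).counter + slackOf τ⟩

/-- The instance of the edge `(u, v)`, already removed from both heaps, is mature: relabel the edge,
record a flip, and restart the instance with a new threshold. -/
noncomputable def relabel (ε ρ δstar : ℝ) (st : State n) (F : List (Fin n × Fin n))
    (u v : Fin n) (oldLabel : Bool) : Rand (State n × List (Fin n × Fin n)) := do
  let (st, label) ← strategy ε ρ δstar st u v
  let st ← startRound st u v label (threshold ε ρ st u v)
  return (st, if label = oldLabel then F else (u, v) :: F)

/-- The top entry of `DtHeap(u)`, that of the edge `(u, v)`, is checkpoint-ready: pop it and let `u`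
inform the coordinator of `(u, v)`. -/
noncomputable def processEntry (ε ρ δstar : ℝ) (st : State n) (F : List (Fin n × Fin n))
    (u v : Fin n) : Rand (State n × List (Fin n × Fin n)) := do
  let (st, e) ← popEntry st u v
  let c ← Rand.ofTimed (st.coords.find? (edgeKey u v))
  match c with
  | none => Rand.fault
  | some c =>
    -- the current round goes on unless this is the last signal of the round
    if c.signals + 1 < (if c.tau ≤ 8 then c.tau else 2) then
      let st ← setCoord st u v { c with signals := c.signals + 1 }
      let st ← pushEntry st u v { e with checkpoint := e.checkpoint + c.slack }
      return (st, F)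
    else
      -- the coordinator collects the exact counters of both participants
      let (st, e') ← popEntry st v u
      let τ := c.tau - (((st.vert u).counter - e.sbar) + ((st.vert v).counter - e'.sbar))
      if τ = 0 then relabel ε ρ δstar st F u v c.label
      else
        let st ← startRound st u v c.label τ
        return (st, F)

/-- While the top entry of `DtHeap(u)` is checkpoint-ready, process it. A loop that does not stop
within `fuel` iterations counts as one that does not halt. -/
noncomputable def drain (ε ρ δstar : ℝ) (u : Fin n) :
    (fuel : ℕ) → State n → List (Fin n × Fin n) → Rand (State n × List (Fin n × Fin n))
  | fuel, st, F => do
    Rand.tick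
    let top ← Rand.ofTimed (st.vert u).dtHeap.min?
    match top with
    | none => return (st, F)
    | some p =>
      if (ofLex p).1 = (st.vert u).counter then
        match fuel with
        | 0 => Rand.fault
        | fuel + 1 =>
          let (st, F) ← processEntry ε ρ δstar st F u (ofLex p).2
          drain ε ρ δstar u fuel st F
      else return (st, F)

/-! ### Updates -/

/-- An update: the insertion or the deletion of an edge `(u, w)`. -/
inductive Update (n : ℕ) : Type where
  | insert (u w : Fin n) : Update n
  | delete (u w : Fin n) : Update n

/-- Increment the shared counter of `u`. -/
noncomputable def incrCounter (st : State n) (u : Fin n) : Rand (State n) := do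
  Rand.tick
  return st.setVert u { st.vert u with counter := (st.vert u).counter + 1 }

/-- Insert the edge `(u, w)` in the graph, with entries that are not on the heaps yet. -/
noncomputable def insertEdge (st : State n) (u w : Fin n) : Rand (State n) := do
  Rand.tick
  let nu ← Rand.ofTimed ((st.vert u).nbrs.insert w ⟨0, 0⟩)
  let nw ← Rand.ofTimed ((st.vert w).nbrs.insert u ⟨0, 0⟩)
  let st := st.setVert u { st.vert u with nbrs := nu }
  return st.setVert w { st.vert w with nbrs := nw }

/-- Delete the edge `(u, w)`, whose entries are no longer on the heaps, and its coordinator. -/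
noncomputable def deleteEdge (st : State n) (u w : Fin n) : Rand (State n) := do
  Rand.tick
  let nu ← Rand.ofTimed ((st.vert u).nbrs.erase w)
  let nw ← Rand.ofTimed ((st.vert w).nbrs.erase u)
  let cs ← Rand.ofTimed (st.coords.erase (edgeKey u w))
  let st := st.setVert u { st.vert u with nbrs := nu }
  let st := st.setVert w { st.vert w with nbrs := nw }
  return { st with coords := cs }

/-- Step 2, insertion: insert the edge, label it, and create its tracking instance. -/
noncomputable def stepInsert (ε ρ δstar : ℝ) (st : State n) (u w : Fin n) :
    Rand (State n × List (Fin n × Fin n)) := do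
  let st ← insertEdge st u w
  let (st, label) ← strategy ε ρ δstar st u w
  let st ← startRound st u w label (threshold ε ρ st u w)
  return (st, if label then [(u, w)] else [])

/-- Step 2, deletion: delete the edge and its tracking instance. -/
noncomputable def stepDelete (st : State n) (u w : Fin n) :
    Rand (State n × List (Fin n × Fin n)) := do
  let c ← Rand.ofTimed (st.coords.find? (edgeKey u w))
  match c with
  | none => Rand.fault
  | some c =>
    let (st, _) ← popEntry st u w
    let (st, _) ← popEntry st w u
    let st ← deleteEdge st u w
    return (st, if c.label then [(u, w)] else [])

/-- The endpoints of the edge of an update. -/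
def Update.endpoints : Update n → Fin n × Fin n
  | .insert u w => (u, w)
  | .delete u w => (u, w)

/-- Handle one update; the result is the new state and the list of the edges whose label flipped.
The two loops run for at most `n` iterations each, since a vertex has fewer than `n` edges and a
processed entry gets a checkpoint beyond the counter. -/
noncomputable def update (ε ρ δstar : ℝ) (st : State n) (up : Update n) :
    Rand (State n × List (Fin n × Fin n)) := do
  let (u, w) := up.endpoints
  let st ← incrCounter st u
  let st ← incrCounter st w
  let (st, F) ←
    match up with
    | .insert u w => stepInsert ε ρ δstar st u w
    | .delete u w => stepDelete st u w
  let (st, F) ← drain ε ρ δstar u n st F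
  drain ε ρ δstar w n st F

/-- Handle a sequence of updates, starting from the given state. -/
noncomputable def runFrom (ε ρ δstar : ℝ) : State n → List (Update n) → Rand (State n)
  | st, [] => return st
  | st, up :: ups => do
    let (st, _) ← update ε ρ δstar st up
    runFrom ε ρ δstar st ups

/-- Handle a sequence of updates of the initially edgeless graph on `n` vertices. -/
noncomputable def run (ε ρ δstar : ℝ) (ups : List (Update n)) : Rand (State n) :=
  runFrom ε ρ δstar (State.empty n) ups

/-- From the graph `G` on, each update inserts a new edge or deletes an existing one. -/
def ValidFrom : SimpleGraph (Fin n) → List (Update n) → Prop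
  | _, [] => True
  | G, .insert u w :: ups => u ≠ w ∧ ¬ G.Adj u w ∧ ValidFrom (G ⊔ SimpleGraph.edge u w) ups
  | G, .delete u w :: ups => G.Adj u w ∧ ValidFrom (G.deleteEdges {s(u, w)}) ups

end Algorithm

end DynELM

/-!
The bound is an amortized one, and it holds for every outcome of the random choices because these
only affect the labels, which do not affect the running time.

*Search trees.* The trees are AVL trees with `O(n ^ 2)` keys, so each operation takes
`H = treeCost n = O(log n)` steps. The memory is described by its mathematical content (`Model`,
`Rep`), on which the elementary operations act as plain updates of functions. The
invariant `Inv` says what is stored for an edge and for a pair that is not an edge; it implies that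
no operation faults.

*Invocations of the labelling strategy.* Let `κ = ρ ε / 2`. The instance of an edge matures only
after `τ₀` increments, where `τ₀ > κ max (d[u], d[v])` for the degrees at the time of its start. A
round never overshoots its threshold by more than one (`RoundInv.add_le`), and a degree grows only
together with the counter, so the current degrees are at most `2 τ₀ / κ` throughout
(`EdgeInv.mul_deg_le`). Let the progress potential be the sum over all instances of the fraction of
`τ₀` that has been reached. An increment of the counter of `u` adds at most `1 / τ₀ ≤ 2 / (κ d[u])`
for each of `d[u]` edges, hence at most `2 / κ` in total (`Inv.progPot_advance_le`), and a maturing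
instance releases one unit. Therefore `M` updates cause at most `(4 / κ + 1) M` invocations. As `M`
is polynomial in `n`, each of them draws `O(log n)` samples
(`log_two_div_invocationDelta_le`) and takes `O(log² n)` steps.

*Signals.* A long round that does not complete its threshold halves it, up to an additive constant
(`RoundInv.remaining`), so an instance receives `O(log n)` signals in its lifetime. The signal
potential `Model.signalPot` counts those still to come. A signal consumes one unit of it and takes
`O(H)` steps, and a new instance brings `O(log n)` units, which are charged to the invocation that
labels its edge (`relabelCost`, `Rep.ensures_processEntry`).

*Termination.* A processed checkpoint moves beyond the counter, so the set of due checkpoints of the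
vertex shrinks with each iteration of the loop (`Rep.ensures_drain`).
-/

namespace DynELM

/-! ### Balanced search trees -/

@[simp] theorem Timed.val_bind {α β : Type} (x : Timed α) (f : α → Timed β) :
    (x >>= f).val = (f x.val).val := rfl
@[simp] theorem Timed.time_bind {α β : Type} (x : Timed α) (f : α → Timed β) :
    (x >>= f).time = x.time + (f x.val).time := rfl
@[simp] theorem Timed.val_pure {α : Type} (a : α) : (pure a : Timed α).val = a := rfl
@[simp] theorem Timed.time_pure {α : Type} (a : α) : (pure a : Timed α).time = 0 := rfl
@[simp] theorem Timed.time_tick : Timed.tick.time = 1 := rfl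

namespace AVL

variable {κ ν : Type}

/-- The bindings of a tree, from left to right. -/
def toList : AVL κ ν → List (κ × ν)
  | nil => []
  | node _ _ l k v r => toList l ++ (k, v) :: toList r

theorem height_nil : (nil : AVL κ ν).height = 0 := rfl
theorem height_node (h s : ℕ) (l : AVL κ ν) (k : κ) (v : ν) (r : AVL κ ν) :
    (node h s l k v r).height = h := rfl
theorem size_nil : (nil : AVL κ ν).size = 0 := rfl
theorem size_node (h s : ℕ) (l : AVL κ ν) (k : κ) (v : ν) (r : AVL κ ν) :
    (node h s l k v r).size = s := rfl
theorem height_mk (l : AVL κ ν) (k : κ) (v : ν) (r : AVL κ ν) :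
    (AVL.mk l k v r).height = max l.height r.height + 1 := rfl
theorem rotateRight_node (h s : ℕ) (l : AVL κ ν) (k : κ) (v : ν) (m : AVL κ ν) (k' : κ) (v' : ν)
    (r : AVL κ ν) : rotateRight (node h s l k v m) k' v' r = mk l k v (mk m k' v' r) := rfl
theorem rotateLeft_node (l : AVL κ ν) (k : κ) (v : ν) (h s : ℕ) (m : AVL κ ν) (k' : κ) (v' : ν)
    (r : AVL κ ν) : rotateLeft l k v (node h s m k' v' r) = mk (mk l k v m) k' v' r := rfl

/-- The stored heights and sizes are correct, and the heights of siblings differ by at most one. -/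
def Balanced : AVL κ ν → Prop
  | nil => True
  | node h s l _ _ r => Balanced l ∧ Balanced r ∧ h = max l.height r.height + 1 ∧
      s = l.size + r.size + 1 ∧ l.height ≤ r.height + 1 ∧ r.height ≤ l.height + 1

theorem Balanced.mk {l r : AVL κ ν} (hl : Balanced l) (hr : Balanced r)
    (h₁ : l.height ≤ r.height + 1) (h₂ : r.height ≤ l.height + 1) (k : κ) (v : ν) :
    Balanced (AVL.mk l k v r) := ⟨hl, hr, rfl, rfl, h₁, h₂⟩

@[simp] theorem toList_mk (l : AVL κ ν) (k : κ) (v : ν) (r : AVL κ ν) :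
    (AVL.mk l k v r).toList = l.toList ++ (k, v) :: r.toList := rfl

theorem toList_rotateRight (l : AVL κ ν) (k : κ) (v : ν) (r : AVL κ ν) :
    (rotateRight l k v r).toList = l.toList ++ (k, v) :: r.toList := by
  cases l <;> simp [rotateRight, toList]

theorem toList_rotateLeft (l : AVL κ ν) (k : κ) (v : ν) (r : AVL κ ν) :
    (rotateLeft l k v r).toList = l.toList ++ (k, v) :: r.toList := by
  cases r <;> simp [rotateLeft, toList]

theorem toList_balance (l : AVL κ ν) (k : κ) (v : ν) (r : AVL κ ν) :
    (balance l k v r).toList = l.toList ++ (k, v) :: r.toList := by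
  unfold balance
  split_ifs
  · cases l
    · rfl
    · dsimp only
      split_ifs <;> simp [toList_rotateRight, toList_rotateLeft, toList]
  · cases r
    · rfl
    · dsimp only
      split_ifs <;> simp [toList_rotateRight, toList_rotateLeft, toList]
  · rfl

/-- Rebalancing siblings whose heights differ by at most two adds zero or one to the larger height,
and exactly one if nothing had to be rotated. -/
theorem Balanced.balance {l r : AVL κ ν} (hl : Balanced l) (hr : Balanced r)
    (h₁ : l.height ≤ r.height + 2) (h₂ : r.height ≤ l.height + 2) (k : κ) (v : ν) :
    Balanced (balance l k v r) ∧
      max l.height r.height ≤ (AVL.balance l k v r).height ∧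
      (AVL.balance l k v r).height ≤ max l.height r.height + 1 ∧
      (l.height ≤ r.height + 1 → r.height ≤ l.height + 1 →
        (AVL.balance l k v r).height = max l.height r.height + 1) := by
  unfold AVL.balance
  split_ifs with c₁ c₂
  · rcases l with _ | ⟨h, s, ll, lk, lv, lr⟩
    · simp [height_nil] at c₁
    · obtain ⟨bll, blr, eh, es, b₁, b₂⟩ := hl
      simp only [height_node] at c₁ h₁ h₂ ⊢
      split_ifs with c₃
      · rw [rotateRight_node]
        refine ⟨bll.mk (blr.mk hr ?_ ?_ _ _) ?_ ?_ _ _, ?_⟩ <;>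
          (try simp only [height_mk]) <;> omega
      · rcases lr with _ | ⟨h', s', a, ak, av, b⟩
        · simp [height_nil] at c₃
        · obtain ⟨ba, bb, eh', es', b₁', b₂'⟩ := blr
          simp only [height_node] at c₃ b₁ b₂ eh
          rw [rotateLeft_node, AVL.mk, rotateRight_node]
          refine ⟨(bll.mk ba ?_ ?_ _ _).mk (bb.mk hr ?_ ?_ _ _) ?_ ?_ _ _, ?_⟩ <;>
            (try simp only [height_mk]) <;> omega
  · rcases r with _ | ⟨h, s, rl, rk, rv, rr⟩
    · simp [height_nil] at c₂
    · obtain ⟨brl, brr, eh, es, b₁, b₂⟩ := hr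
      simp only [height_node] at c₂ h₁ h₂ ⊢
      split_ifs with c₃
      · rw [rotateLeft_node]
        refine ⟨(hl.mk brl ?_ ?_ _ _).mk brr ?_ ?_ _ _, ?_⟩ <;>
          (try simp only [height_mk]) <;> omega
      · rcases rl with _ | ⟨h', s', a, ak, av, b⟩
        · simp [height_nil] at c₃
        · obtain ⟨ba, bb, eh', es', b₁', b₂'⟩ := brl
          simp only [height_node] at c₃ b₁ b₂ eh
          rw [rotateRight_node, AVL.mk, rotateLeft_node]
          refine ⟨(hl.mk ba ?_ ?_ _ _).mk (bb.mk brr ?_ ?_ _ _) ?_ ?_ _ _, ?_⟩ <;>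
            (try simp only [height_mk]) <;> omega
  · refine ⟨hl.mk hr (by omega) (by omega) k v, ?_⟩
    rw [height_mk]
    exact ⟨by omega, le_rfl, fun _ _ => rfl⟩

theorem Balanced.size_eq : ∀ {t : AVL κ ν}, Balanced t → t.size = t.toList.length
  | nil, _ => rfl
  | node _ _ l _ _ r, ⟨hl, hr, _, hs, _, _⟩ => by
    simp only [size_node, toList, List.length_append, List.length_cons, hs, hl.size_eq, hr.size_eq]
    omega

/-- An AVL tree of height `h` has at least `2 ^ ⌊h / 2⌋ - 1` nodes. -/
theorem Balanced.two_pow_height_le :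
    ∀ {t : AVL κ ν}, Balanced t → 2 ^ (t.height / 2) ≤ t.size + 1
  | nil, _ => by simp [height_nil, size_nil]
  | node h s l _ _ r, ⟨hl, hr, hh, hs, h₁, h₂⟩ => by
    have il := hl.two_pow_height_le
    have ir := hr.two_pow_height_le
    simp only [height_node, size_node]
    rcases Nat.lt_or_ge h 2 with h2 | h2
    · have : h / 2 = 0 := by omega
      rw [this]; omega
    · have e : h / 2 = (h - 2) / 2 + 1 := by omega
      have el : 2 ^ ((h - 2) / 2) ≤ 2 ^ (l.height / 2) :=
        Nat.pow_le_pow_right (by norm_num) (by omega)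
      have er : 2 ^ ((h - 2) / 2) ≤ 2 ^ (r.height / 2) :=
        Nat.pow_le_pow_right (by norm_num) (by omega)
      rw [e, pow_succ]
      omega

theorem Balanced.height_le_log {t : AVL κ ν} (h : Balanced t) {N : ℕ} (hN : t.size ≤ N) :
    t.height + 1 ≤ 2 * Nat.log 2 (N + 1) + 2 := by
  have h1 : 2 ^ (t.height / 2) ≤ N + 1 := h.two_pow_height_le.trans (by omega)
  have := Nat.le_log_of_pow_le (by norm_num) h1
  omega

/-! ### Operations on balanced search trees -/

theorem Balanced.splitMin : ∀ {l : AVL κ ν} {r : AVL κ ν} (h s : ℕ) (k : κ) (v : ν),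
    Balanced (node h s l k v r) →
      Balanced (splitMin l k v r).val.2 ∧ (AVL.splitMin l k v r).val.2.height ≤ h ∧
      h ≤ (AVL.splitMin l k v r).val.2.height + 1 ∧ (AVL.splitMin l k v r).time ≤ h ∧
      (AVL.splitMin l k v r).val.1 :: (AVL.splitMin l k v r).val.2.toList =
        (node h s l k v r).toList
  | nil, r, h, s, k, v, hb => by
    obtain ⟨hl, hr, hh, hs, h₁, h₂⟩ := hb
    simp only [height_nil] at hh h₁ h₂
    simp only [AVL.splitMin, Timed.val_bind, Timed.val_pure, Timed.time_bind, Timed.time_tick,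
      Timed.time_pure, toList, List.nil_append, hr, true_and, and_true]
    omega
  | node h' s' ll lk lv lr, r, h, s, k, v, hb => by
    obtain ⟨hl, hr, hh, hs, h₁, h₂⟩ := hb
    obtain ⟨a, b, c, d, e⟩ := Balanced.splitMin h' s' lk lv hl
    simp only [height_node] at hh h₁ h₂
    obtain ⟨p, q, q', q''⟩ := a.balance hr (by omega) (by omega) k v
    simp only [AVL.splitMin, Timed.val_bind, Timed.val_pure, Timed.time_bind, Timed.time_tick,
      Timed.time_pure, toList_balance]
    refine ⟨p, by omega, by omega, by omega, ?_⟩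
    rw [← List.cons_append, e]
    rfl

theorem Balanced.glue {l r : AVL κ ν} (hl : Balanced l) (hr : Balanced r)
    (h₁ : l.height ≤ r.height + 1) (h₂ : r.height ≤ l.height + 1) :
    Balanced (glue l r).val ∧ (AVL.glue l r).val.height ≤ max l.height r.height + 1 ∧
      max l.height r.height ≤ (AVL.glue l r).val.height ∧
      (AVL.glue l r).time ≤ r.height + 1 ∧
      (AVL.glue l r).val.toList = l.toList ++ r.toList := by
  rcases r with _ | ⟨h, s, rl, rk, rv, rr⟩
  · simp only [height_nil] at h₁ h₂
    simp [AVL.glue, hl, toList, height_nil]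
  · obtain ⟨a, b, c, d, e⟩ := Balanced.splitMin h s rk rv hr
    simp only [height_node] at h₁ h₂ ⊢
    obtain ⟨p, q, q', q''⟩ := hl.balance a (by omega) (by omega) (AVL.splitMin rl rk rv rr).val.1.1
      (AVL.splitMin rl rk rv rr).val.1.2
    simp only [AVL.glue, Timed.val_bind, Timed.val_pure, Timed.time_bind,
      Timed.time_pure, toList_balance]
    refine ⟨p, by omega, by omega, by omega, ?_⟩
    rw [← e]

theorem select_isSome : ∀ {t : AVL κ ν} (i : ℕ), Balanced t → i < t.size →
    ((select i t).val).isSome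
  | nil, i, _, hi => by simp [size_nil] at hi
  | node h s l k v r, i, ⟨hl, hr, hh, hs, h₁, h₂⟩, hi => by
    simp only [size_node] at hi
    simp only [select, Timed.val_bind]
    split_ifs with c₁ c₂
    · exact select_isSome i hl c₁
    · rfl
    · exact select_isSome _ hr (by omega)

theorem select_time : ∀ {t : AVL κ ν} (i : ℕ), Balanced t →
    (select i t).time ≤ t.height + 1
  | nil, i, _ => by simp [select]
  | node h s l k v r, i, ⟨hl, hr, hh, hs, h₁, h₂⟩ => by
    have := select_time i hl
    have := select_time (i - l.size - 1) hr
    simp only [select, Timed.time_bind, Timed.time_tick, height_node]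
    split_ifs with c₁ c₂ <;> (try simp only [Timed.time_pure]) <;> omega

theorem min?_time : ∀ {t : AVL κ ν}, Balanced t → (min? t).time ≤ t.height + 1
  | nil, _ => by simp [min?]
  | node h s nil k v r, _ => by simp [min?]
  | node h s (node h' s' ll lk lv lr) k v r, ⟨hl, hr, hh, hs, h₁, h₂⟩ => by
    have := min?_time hl
    simp only [height_node] at hh this
    simp only [min?, Timed.time_bind, Timed.time_tick, height_node]
    omega

theorem min?_val : ∀ (t : AVL κ ν), (min? t).val = t.toList.head?.map Prod.fst
  | nil => rfl
  | node _ _ nil _ _ _ => rfl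
  | node _ _ (node h' s' ll lk lv lr) k v r => by
    have := min?_val (node h' s' ll lk lv lr)
    simp only [min?, Timed.val_bind, this]
    simp [toList]

variable [LinearOrder κ]

/-- Balanced search trees. -/
structure WF (t : AVL κ ν) : Prop where
  balanced : t.Balanced
  sorted : t.toList.Pairwise fun a b => a.1 < b.1

/-- The finite map represented by a search tree. -/
def get (t : AVL κ ν) (x : κ) : Option ν := (t.find? x).val

theorem wf_nil : WF (nil : AVL κ ν) := ⟨trivial, List.Pairwise.nil⟩

@[simp] theorem get_nil (x : κ) : get (nil : AVL κ ν) x = none := rfl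

theorem get_eq_some_of_sorted : ∀ {t : AVL κ ν}, (t.toList.Pairwise fun a b => a.1 < b.1) →
    ∀ {x : κ} {y : ν}, t.get x = some y ↔ (x, y) ∈ t.toList
  | nil, _, x, y => by simp [toList]
  | node h s l k v r, hs, x, y => by
    simp only [toList, List.pairwise_append, List.pairwise_cons, List.mem_cons] at hs
    obtain ⟨hl, ⟨hkr, hr⟩, hlr⟩ := hs
    have il := @get_eq_some_of_sorted l hl x y
    have ir := @get_eq_some_of_sorted r hr x y
    simp only [get] at il ir
    have hl' : (x, y) ∈ l.toList → x < k := fun h => hlr _ h (k, v) (Or.inl rfl)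
    have hr' : (x, y) ∈ r.toList → k < x := fun h => hkr _ h
    simp only [get, find?, Timed.val_bind, toList, List.mem_append, List.mem_cons, Prod.mk.injEq]
    split_ifs with c₁ c₂
    · rw [il]
      refine ⟨Or.inl, ?_⟩
      rintro (h | h | h)
      · exact h
      · exact absurd h.1 c₁.ne
      · exact absurd (hr' h) c₁.asymm
    · rw [ir]
      refine ⟨fun h => Or.inr (Or.inr h), ?_⟩
      rintro (h | h | h)
      · exact absurd (hl' h) c₂.asymm
      · exact absurd h.1.symm c₂.ne
      · exact h
    · have e : x = k := le_antisymm (not_lt.1 c₂) (not_lt.1 c₁)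
      simp only [Timed.val_pure, Option.some.injEq]
      refine ⟨fun h => Or.inr (Or.inl ⟨e, h.symm⟩), ?_⟩
      rintro (h | h | h)
      · exact absurd (hl' h) c₁
      · exact h.2.symm
      · exact absurd (hr' h) c₂

theorem WF.get_eq_some {t : AVL κ ν} (h : t.WF) {x : κ} {y : ν} :
    t.get x = some y ↔ (x, y) ∈ t.toList := get_eq_some_of_sorted h.sorted

theorem find?_time (x : κ) : ∀ {t : AVL κ ν}, Balanced t → (find? x t).time ≤ t.height + 1
  | nil, _ => by simp [find?]
  | node h s l k v r, ⟨hl, hr, hh, hs, h₁, h₂⟩ => by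
    have := find?_time x hl
    have := find?_time x hr
    simp only [find?, Timed.time_bind, Timed.time_tick, height_node]
    split_ifs with c₁ c₂ <;> (try simp only [Timed.time_pure]) <;> omega

theorem Balanced.insert (x : κ) (y : ν) : ∀ {t : AVL κ ν}, Balanced t →
    Balanced (insert x y t).val ∧ t.height ≤ (AVL.insert x y t).val.height ∧
      (AVL.insert x y t).val.height ≤ t.height + 1 ∧ (AVL.insert x y t).time ≤ t.height + 1
  | nil, _ => by simp [AVL.insert, AVL.mk, Balanced, height_nil, height_node, size_nil]
  | node h s l k v r, ⟨hl, hr, hh, hs, h₁, h₂⟩ => by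
    simp only [AVL.insert, Timed.val_bind, Timed.time_bind, Timed.time_tick, height_node]
    split_ifs with c₁ c₂
    · obtain ⟨a, b, c, d⟩ := hl.insert x y
      obtain ⟨p, q, q', q''⟩ := a.balance hr (by omega) (by omega) k v
      simp only [Timed.val_bind, Timed.time_bind, Timed.val_pure, Timed.time_pure]
      refine ⟨p, ?_⟩; omega
    · obtain ⟨a, b, c, d⟩ := hr.insert x y
      obtain ⟨p, q, q', q''⟩ := hl.balance a (by omega) (by omega) k v
      simp only [Timed.val_bind, Timed.time_bind, Timed.val_pure, Timed.time_pure]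
      refine ⟨p, ?_⟩; omega
    · exact ⟨⟨hl, hr, hh, hs, h₁, h₂⟩, le_rfl, Nat.le_succ _, by simp⟩

theorem Balanced.erase (x : κ) : ∀ {t : AVL κ ν}, Balanced t →
    Balanced (erase x t).val ∧ (AVL.erase x t).val.height ≤ t.height ∧
      t.height ≤ (AVL.erase x t).val.height + 1 ∧ (AVL.erase x t).time ≤ t.height + 1
  | nil, _ => by simp [AVL.erase, Balanced, height_nil]
  | node h s l k v r, ⟨hl, hr, hh, hs, h₁, h₂⟩ => by
    simp only [AVL.erase, Timed.val_bind, Timed.time_bind, Timed.time_tick, height_node]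
    split_ifs with c₁ c₂
    · obtain ⟨a, b, c, d⟩ := hl.erase x
      obtain ⟨p, q, q', q''⟩ := a.balance hr (by omega) (by omega) k v
      simp only [Timed.val_bind, Timed.time_bind, Timed.val_pure, Timed.time_pure]
      refine ⟨p, ?_⟩; omega
    · obtain ⟨a, b, c, d⟩ := hr.erase x
      obtain ⟨p, q, q', q''⟩ := hl.balance a (by omega) (by omega) k v
      simp only [Timed.val_bind, Timed.time_bind, Timed.val_pure, Timed.time_pure]
      refine ⟨p, ?_⟩; omega
    · obtain ⟨p, q, q', q'', _⟩ := hl.glue hr h₁ h₂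
      refine ⟨p, ?_⟩; omega

theorem mem_insert (x : κ) (y : ν) : ∀ {t : AVL κ ν},
    (t.toList.Pairwise fun a b => a.1 < b.1) → ∀ (p : κ × ν),
    p ∈ (insert x y t).val.toList ↔ p = (x, y) ∨ p.1 ≠ x ∧ p ∈ t.toList
  | nil, _, p => by simp [AVL.insert, toList]
  | node h s l k v r, hs, p => by
    simp only [toList, List.pairwise_append, List.pairwise_cons, List.mem_cons] at hs
    obtain ⟨hl, ⟨hkr, hr⟩, hlr⟩ := hs
    have il := mem_insert x y hl p
    have ir := mem_insert x y hr p
    have hl' : p ∈ l.toList → p.1 < k := fun h => hlr _ h (k, v) (Or.inl rfl)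
    have hr' : p ∈ r.toList → k < p.1 := fun h => hkr _ h
    have hk : p = (k, v) → p.1 = k := fun h => by rw [h]
    simp only [AVL.insert, Timed.val_bind, toList, List.mem_append, List.mem_cons]
    split_ifs with c₁ c₂
    · simp only [Timed.val_bind, Timed.val_pure, toList_balance, List.mem_append, List.mem_cons, il]
      have h1 : p = (k, v) → p.1 ≠ x := fun h => by rw [hk h]; exact c₁.ne'
      have h2 : p ∈ r.toList → p.1 ≠ x := fun h => (c₁.trans (hr' h)).ne'
      grind only
    · simp only [Timed.val_bind, Timed.val_pure, toList_balance, List.mem_append, List.mem_cons, ir]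
      have h1 : p = (k, v) → p.1 ≠ x := fun h => by rw [hk h]; exact c₂.ne
      have h2 : p ∈ l.toList → p.1 ≠ x := fun h => ((hl' h).trans c₂).ne
      grind only
    · have e : x = k := le_antisymm (not_lt.1 c₂) (not_lt.1 c₁)
      subst e
      simp only [Timed.val_pure, toList, List.mem_append, List.mem_cons]
      have h1 : p ∈ l.toList → p.1 ≠ x := fun h => (hl' h).ne
      have h2 : p ∈ r.toList → p.1 ≠ x := fun h => (hr' h).ne'
      grind only

theorem mem_erase (x : κ) : ∀ {t : AVL κ ν}, t.Balanced →
    (t.toList.Pairwise fun a b => a.1 < b.1) → ∀ (p : κ × ν),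
    p ∈ (erase x t).val.toList ↔ p.1 ≠ x ∧ p ∈ t.toList
  | nil, _, _, p => by simp [AVL.erase, toList]
  | node h s l k v r, ⟨bl, br, _, _, b₁, b₂⟩, hs, p => by
    simp only [toList, List.pairwise_append, List.pairwise_cons, List.mem_cons] at hs
    obtain ⟨hl, ⟨hkr, hr⟩, hlr⟩ := hs
    have il := mem_erase x bl hl p
    have ir := mem_erase x br hr p
    have hl' : p ∈ l.toList → p.1 < k := fun h => hlr _ h (k, v) (Or.inl rfl)
    have hr' : p ∈ r.toList → k < p.1 := fun h => hkr _ h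
    have hk : p = (k, v) → p.1 = k := fun h => by rw [h]
    simp only [AVL.erase, Timed.val_bind, toList, List.mem_append, List.mem_cons]
    split_ifs with c₁ c₂
    · simp only [Timed.val_bind, Timed.val_pure, toList_balance, List.mem_append, List.mem_cons, il]
      have h1 : p = (k, v) → p.1 ≠ x := fun h => by rw [hk h]; exact c₁.ne'
      have h2 : p ∈ r.toList → p.1 ≠ x := fun h => (c₁.trans (hr' h)).ne'
      grind only
    · simp only [Timed.val_bind, Timed.val_pure, toList_balance, List.mem_append, List.mem_cons, ir]
      have h1 : p = (k, v) → p.1 ≠ x := fun h => by rw [hk h]; exact c₂.ne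
      have h2 : p ∈ l.toList → p.1 ≠ x := fun h => ((hl' h).trans c₂).ne
      grind only
    · have e : x = k := le_antisymm (not_lt.1 c₂) (not_lt.1 c₁)
      subst e
      rw [(bl.glue br b₁ b₂).2.2.2.2, List.mem_append]
      have h1 : p ∈ l.toList → p.1 ≠ x := fun h => (hl' h).ne
      have h2 : p ∈ r.toList → p.1 ≠ x := fun h => (hr' h).ne'
      grind only

theorem sorted_insert (x : κ) (y : ν) : ∀ {t : AVL κ ν},
    (t.toList.Pairwise fun a b => a.1 < b.1) →
    (insert x y t).val.toList.Pairwise fun a b => a.1 < b.1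
  | nil, _ => by simp [AVL.insert, toList]
  | node h s l k v r, hs => by
    have hs' := hs
    simp only [toList, List.pairwise_append, List.pairwise_cons, List.mem_cons] at hs
    obtain ⟨hl, ⟨hkr, hr⟩, hlr⟩ := hs
    simp only [AVL.insert, Timed.val_bind]
    split_ifs with c₁ c₂
    · simp only [Timed.val_bind, Timed.val_pure, toList_balance, List.pairwise_append,
        List.pairwise_cons, List.mem_cons, mem_insert x y hl]
      refine ⟨sorted_insert x y hl, ⟨hkr, hr⟩, ?_⟩
      rintro a (rfl | ⟨-, ha⟩) b hb
      · rcases hb with rfl | hb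
        · exact c₁
        · exact c₁.trans (hkr _ hb)
      · exact hlr _ ha _ hb
    · simp only [Timed.val_bind, Timed.val_pure, toList_balance, List.pairwise_append,
        List.pairwise_cons, List.mem_cons, mem_insert x y hr]
      refine ⟨hl, ⟨?_, sorted_insert x y hr⟩, ?_⟩
      · rintro a (rfl | ⟨-, ha⟩)
        · exact c₂
        · exact hkr _ ha
      · rintro a ha b (rfl | rfl | ⟨-, hb⟩)
        · exact hlr _ ha _ (Or.inl rfl)
        · exact (hlr _ ha (k, v) (Or.inl rfl)).trans c₂
        · exact hlr _ ha _ (Or.inr hb)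
    · have e : x = k := le_antisymm (not_lt.1 c₂) (not_lt.1 c₁)
      subst e
      simp only [Timed.val_pure, toList, List.pairwise_append, List.pairwise_cons, List.mem_cons]
      refine ⟨hl, ⟨hkr, hr⟩, ?_⟩
      rintro a ha b (rfl | hb)
      · exact hlr _ ha (x, v) (Or.inl rfl)
      · exact hlr _ ha _ (Or.inr hb)

theorem sorted_erase (x : κ) : ∀ {t : AVL κ ν}, t.Balanced →
    (t.toList.Pairwise fun a b => a.1 < b.1) →
    (erase x t).val.toList.Pairwise fun a b => a.1 < b.1
  | nil, _, _ => by simp [AVL.erase, toList]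
  | node h s l k v r, ⟨bl, br, _, _, b₁, b₂⟩, hs => by
    simp only [toList, List.pairwise_append, List.pairwise_cons, List.mem_cons] at hs
    obtain ⟨hl, ⟨hkr, hr⟩, hlr⟩ := hs
    simp only [AVL.erase, Timed.val_bind]
    split_ifs with c₁ c₂
    · simp only [Timed.val_bind, Timed.val_pure, toList_balance, List.pairwise_append,
        List.pairwise_cons, List.mem_cons, mem_erase x bl hl]
      exact ⟨sorted_erase x bl hl, ⟨hkr, hr⟩, fun a ha b hb => hlr a ha.2 b hb⟩
    · simp only [Timed.val_bind, Timed.val_pure, toList_balance, List.pairwise_append,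
        List.pairwise_cons, List.mem_cons, mem_erase x br hr]
      exact ⟨hl, ⟨fun a ha => hkr a ha.2, sorted_erase x br hr⟩,
        fun a ha b hb => hlr a ha b (hb.imp_right And.right)⟩
    · rw [(bl.glue br b₁ b₂).2.2.2.2, List.pairwise_append]
      exact ⟨hl, hr, fun a ha b hb => hlr a ha b (Or.inr hb)⟩

theorem WF.insert {t : AVL κ ν} (h : t.WF) (x : κ) (y : ν) : (t.insert x y).val.WF :=
  ⟨(h.balanced.insert x y).1, sorted_insert x y h.sorted⟩

theorem WF.erase {t : AVL κ ν} (h : t.WF) (x : κ) : (t.erase x).val.WF :=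
  ⟨(h.balanced.erase x).1, sorted_erase x h.balanced h.sorted⟩

theorem WF.get_insert {t : AVL κ ν} (h : t.WF) (x : κ) (y : ν) (z : κ) :
    (t.insert x y).val.get z = if z = x then some y else t.get z := by
  ext w
  rw [(h.insert x y).get_eq_some, mem_insert x y h.sorted]
  split_ifs with c
  · simp [c, eq_comm]
  · rw [h.get_eq_some]; simp [c]

theorem WF.get_erase {t : AVL κ ν} (h : t.WF) (x : κ) (z : κ) :
    (t.erase x).val.get z = if z = x then none else t.get z := by
  ext w
  rw [(h.erase x).get_eq_some, mem_erase x h.balanced h.sorted]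
  split_ifs with c
  · simp [c]
  · rw [h.get_eq_some]; simp [c]

theorem WF.min?_eq_none {t : AVL κ ν} (h : t.WF) (hm : t.min?.val = none) (x : κ) :
    t.get x = none := by
  rw [min?_val, Option.map_eq_none_iff, List.head?_eq_none_iff] at hm
  ext w
  simp [h.get_eq_some, hm]

theorem WF.min?_eq_some {t : AVL κ ν} (h : t.WF) {x : κ} (hm : t.min?.val = some x) :
    (∃ y, t.get x = some y) ∧ ∀ z y, t.get z = some y → x ≤ z := by
  rw [min?_val, Option.map_eq_some_iff] at hm
  obtain ⟨⟨a, b⟩, hab, rfl⟩ := hm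
  rw [List.head?_eq_some_iff] at hab
  obtain ⟨tl, htl⟩ := hab
  refine ⟨⟨b, h.get_eq_some.2 (by simp [htl])⟩, fun z y hz => ?_⟩
  have hs := h.sorted
  rw [h.get_eq_some, htl] at hz
  rw [htl, List.pairwise_cons] at hs
  rcases List.mem_cons.1 hz with e | e
  · exact (Prod.mk.inj e).1.symm.le
  · exact (hs.1 _ e).le

/-- A tree has at most as many nodes as a type in which its keys are represented injectively. -/
theorem WF.size_le_card {β : Type} [Fintype β] {t : AVL κ ν} (h : t.WF) (f : κ → β)
    (hf : ∀ x y v w, t.get x = some v → t.get y = some w → f x = f y → x = y) :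
    t.size ≤ Fintype.card β := by
  rw [h.balanced.size_eq, ← List.length_map (f := fun p => f p.1)]
  apply List.Nodup.length_le_card
  refine List.Nodup.map_on ?_ (h.sorted.imp fun hab e => ?_)
  · rintro ⟨x, v⟩ hx ⟨y, w⟩ hy e
    have hx' := h.get_eq_some.2 hx
    have hy' := h.get_eq_some.2 hy
    have e' := hf x y v w hx' hy' e
    subst e'
    rw [hx'] at hy'
    rw [Option.some.inj hy']
  · rw [e] at hab; exact lt_irrefl _ hab

theorem WF.size_eq_card [Fintype κ] {t : AVL κ ν} (h : t.WF) :
    t.size = (Finset.univ.filter fun x => (t.get x).isSome).card := by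
  rw [h.balanced.size_eq, ← List.length_map (f := Prod.fst)]
  have hn : (t.toList.map Prod.fst).Nodup :=
    (List.pairwise_map.2 h.sorted).imp fun hab => ne_of_lt hab
  rw [← List.toFinset_card_of_nodup hn]
  congr 1
  ext x
  simp only [List.mem_toFinset, List.mem_map, Finset.mem_filter, Finset.mem_univ, true_and,
    Option.isSome_iff_exists, h.get_eq_some]
  constructor
  · rintro ⟨⟨a, b⟩, hab, rfl⟩
    exact ⟨b, hab⟩
  · rintro ⟨b, hb⟩
    exact ⟨_, hb, rfl⟩

end AVL

/-! ### Total correctness of randomized computations -/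

namespace Rand

variable {α β : Type}

/-- Whatever its random choices, the computation halts, with a value and a number of steps that
satisfy `Q`. -/
def Ensures (p : Rand α) (Q : α → ℕ → Prop) : Prop :=
  ∀ r ∈ p.dist.support, ∃ a t, r = some (a, t) ∧ Q a t

theorem Ensures.mono {p : Rand α} {P Q : α → ℕ → Prop} (h : p.Ensures P)
    (hPQ : ∀ a t, P a t → Q a t) : p.Ensures Q := fun r hr => by
  obtain ⟨a, t, e, h'⟩ := h r hr
  exact ⟨a, t, e, hPQ a t h'⟩

theorem ensures_of_dist_eq_pure {p : Rand α} {a : α} {t : ℕ} {Q : α → ℕ → Prop}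
    (hp : p.dist = PMF.pure (some (a, t))) (h : Q a t) : p.Ensures Q := fun r hr => by
  rw [hp, PMF.support_pure, Set.mem_singleton_iff] at hr
  exact ⟨a, t, hr, h⟩

theorem ensures_pure {a : α} {Q : α → ℕ → Prop} (h : Q a 0) : (pure a : Rand α).Ensures Q :=
  ensures_of_dist_eq_pure rfl h

theorem ensures_tick : tick.Ensures fun _ t => t = 1 :=
  ensures_of_dist_eq_pure (a := ()) (t := 1) rfl rfl

theorem ensures_ofTimed (x : Timed α) :
    (ofTimed x).Ensures fun a t => a = x.val ∧ t = x.time :=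
  ensures_of_dist_eq_pure (a := x.val) (t := x.time) rfl ⟨rfl, rfl⟩

theorem ensures_uniform (k : ℕ) : (uniform k).Ensures fun _ t => t = 1 := fun r hr => by
  change r ∈ (PMF.map _ _).support at hr
  rw [PMF.support_map] at hr
  obtain ⟨i, -, rfl⟩ := hr
  exact ⟨i, 1, rfl, rfl⟩

theorem Ensures.bind {p : Rand α} {f : α → Rand β} {P : α → ℕ → Prop} {Q : β → ℕ → Prop}
    (hp : p.Ensures P) (hf : ∀ a t, P a t → (f a).Ensures fun b s => Q b (t + s)) :
    (p >>= f).Ensures Q := fun r hr => by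
  change r ∈ (PMF.bind _ _).support at hr
  rw [PMF.mem_support_bind_iff] at hr
  obtain ⟨x, hx, hr⟩ := hr
  obtain ⟨a, t, rfl, hP⟩ := hp x hx
  change r ∈ (PMF.map _ _).support at hr
  rw [PMF.support_map] at hr
  obtain ⟨y, hy, rfl⟩ := hr
  obtain ⟨b, s, rfl, hQ⟩ := hf a t hP y hy
  exact ⟨b, t + s, rfl, hQ⟩

theorem ensures_tick_bind {f : Unit → Rand β} {Q : β → ℕ → Prop}
    (h : (f ()).Ensures fun b s => Q b (1 + s)) : (tick >>= f).Ensures Q :=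
  ensures_tick.bind fun _ _ e => by rw [e]; exact h

theorem ensures_ofTimed_bind {x : Timed α} {f : α → Rand β} {Q : β → ℕ → Prop}
    (h : (f x.val).Ensures fun b s => Q b (x.time + s)) : (ofTimed x >>= f).Ensures Q :=
  (ensures_ofTimed x).bind fun _ _ e => by rw [e.1, e.2]; exact h

end Rand

open DynELM.Rand

variable {n : ℕ}

theorem edgeKey_eq_iff {a b u v : Fin n} : edgeKey a b = edgeKey u v ↔ s(a, b) = s(u, v) := by
  simp only [edgeKey, EmbeddingLike.apply_eq_iff_eq, Prod.mk.injEq, Sym2.eq_iff]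
  rcases le_total a b with h | h <;> rcases le_total u v with h' | h' <;>
    simp only [min_eq_left, min_eq_right, max_eq_left, max_eq_right, h, h'] <;> grind

/-! ### The abstract view of the memory -/

/-- The mathematical content of a memory state: the counters, the entry that each vertex stores for
each neighbour, whether that entry is on the priority queue, the coordinators, and the number of
invocations of the labelling strategy. The last two fields are not stored by the algorithm: for each
edge, the threshold `τ(u, v)` of its tracking instance when the instance was started, and the number
of increments that the instance has received since. -/
structure Model (n : ℕ) where
  ctr : Fin n → ℕ
  ent : Fin n → Fin n → Option Entry
  queued : Fin n → Fin n → Prop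
  crd : Sym2 (Fin n) → Option Coord
  inv : ℕ
  tau0 : Sym2 (Fin n) → ℕ
  prog : Sym2 (Fin n) → ℕ

namespace Model

/-- The number of neighbours of `u`. -/
def deg (m : Model n) (u : Fin n) : ℕ := (Finset.univ.filter fun v => (m.ent u v).isSome).card

/-- Write the entry of `u` for the edge `(u, v)`. -/
def setEnt (m : Model n) (u v : Fin n) (e : Option Entry) : Model n :=
  { m with ent := fun a b => if a = u ∧ b = v then e else m.ent a b }

/-- Change whether the entry of `u` for the edge `(u, v)` is on the priority queue. -/
def setQueued (m : Model n) (u v : Fin n) (q : Prop) : Model n :=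
  { m with queued := fun a b => if a = u ∧ b = v then q else m.queued a b }

/-- Write the coordinator of an edge. -/
def setCrd (m : Model n) (p : Sym2 (Fin n)) (c : Option Coord) : Model n :=
  { m with crd := Function.update m.crd p c }

/-- Increment the counter of `u`. -/
def incr (m : Model n) (u : Fin n) : Model n :=
  { m with ctr := Function.update m.ctr u (m.ctr u + 1) }

/-- Write the entry of `u` for the edge `(u, v)` and put it on the priority queue. -/
def push (m : Model n) (u v : Fin n) (e : Entry) : Model n :=
  (m.setEnt u v (some e)).setQueued u v True

/-- Start a round with threshold `τ` of the instance of the edge `(u, v)`. -/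
def startRound (m : Model n) (u v : Fin n) (label : Bool) (τ : ℕ) : Model n :=
  ((m.setCrd s(u, v) (some ⟨label, τ, slackOf τ, 0⟩)).push u v
    ⟨m.ctr u, m.ctr u + slackOf τ⟩).push v u ⟨m.ctr v, m.ctr v + slackOf τ⟩

end Model

/-- The memory state `st` is well formed and has the content `m`. -/
structure Rep (st : State n) (m : Model n) : Prop where
  ctr : ∀ u, (st.vert u).counter = m.ctr u
  nbrs_wf : ∀ u, (st.vert u).nbrs.WF
  heap_wf : ∀ u, (st.vert u).dtHeap.WF
  coords_wf : st.coords.WF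
  ent : ∀ u v, (st.vert u).nbrs.get v = m.ent u v
  heap : ∀ u c v, ((st.vert u).dtHeap.get (toLex (c, v))).isSome ↔
    m.queued u v ∧ ∃ e, m.ent u v = some e ∧ e.checkpoint = c
  crd : ∀ u v, st.coords.get (edgeKey u v) = m.crd s(u, v)
  inv : st.invocations = m.inv

theorem Rep.empty : Rep (State.empty n) ⟨fun _ => 0, fun _ _ => none, fun _ _ => False,
    fun _ => none, 0, fun _ => 0, fun _ => 0⟩ :=
  ⟨fun _ => rfl, fun _ => AVL.wf_nil, fun _ => AVL.wf_nil, AVL.wf_nil, fun _ _ => rfl,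
    fun u c v => by simp [State.empty], fun _ _ => rfl, rfl⟩

/-- A bound for the number of steps of an operation on a search tree with at most `n ^ 2` nodes. -/
def treeCost (n : ℕ) : ℕ := 2 * Nat.log 2 (n * n + 1) + 2

section Rep

variable {st : State n} {m : Model n}

theorem Rep.degree (h : Rep st m) (u : Fin n) : st.degree u = m.deg u := by
  simp only [State.degree, (h.nbrs_wf u).size_eq_card, h.ent, Model.deg]

theorem Rep.nbrs_height (h : Rep st m) (u : Fin n) :
    (st.vert u).nbrs.height + 1 ≤ treeCost n := by
  refine (h.nbrs_wf u).balanced.height_le_log ?_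
  have := (h.nbrs_wf u).size_le_card id fun x y _ _ _ _ e => e
  rw [Fintype.card_fin] at this
  exact this.trans (Nat.le_mul_self n)

/-- The priority queue of a vertex holds at most one entry for each neighbour. -/
theorem Rep.heap_height (h : Rep st m) (u : Fin n) :
    (st.vert u).dtHeap.height + 1 ≤ treeCost n := by
  refine (h.heap_wf u).balanced.height_le_log ?_
  have := (h.heap_wf u).size_le_card (fun p => (ofLex p).2) fun x y a b hx hy e => by
    have hx' := (h.heap u (ofLex x).1 (ofLex x).2).1
      (Option.isSome_iff_exists.2 ⟨a, hx⟩)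
    have hy' := (h.heap u (ofLex y).1 (ofLex y).2).1
      (Option.isSome_iff_exists.2 ⟨b, hy⟩)
    obtain ⟨-, e₁, h₁, h₁'⟩ := hx'
    obtain ⟨-, e₂, h₂, h₂'⟩ := hy'
    rw [← e, h₁] at h₂
    rw [← Option.some.inj h₂, h₁'] at h₂'
    exact ofLex_inj.1 (Prod.ext h₂' e)
  rw [Fintype.card_fin] at this
  exact this.trans (Nat.le_mul_self n)

theorem Rep.coords_height (h : Rep st m) : st.coords.height + 1 ≤ treeCost n := by
  refine h.coords_wf.balanced.height_le_log ?_
  have := h.coords_wf.size_le_card ofLex fun x y _ _ _ _ e => ofLex_inj.1 e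
  rwa [Fintype.card_prod, Fintype.card_fin] at this

theorem Rep.setVert (h : Rep st m) (u : Fin n) (d : VertexData n) (m' : Model n)
    (hc : d.counter = m'.ctr u) (hn : d.nbrs.WF) (hh : d.dtHeap.WF)
    (he : ∀ v, d.nbrs.get v = m'.ent u v)
    (hq : ∀ c v, (d.dtHeap.get (toLex (c, v))).isSome ↔
      m'.queued u v ∧ ∃ e, m'.ent u v = some e ∧ e.checkpoint = c)
    (ho : ∀ a, a ≠ u → m'.ctr a = m.ctr a ∧ m'.ent a = m.ent a ∧ m'.queued a = m.queued a)
    (hcr : m'.crd = m.crd) (hi : m'.inv = m.inv) : Rep (st.setVert u d) m' := by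
  have key : ∀ a, ((st.setVert u d).vert a = d ∧ a = u) ∨
      ((st.setVert u d).vert a = st.vert a ∧ a ≠ u) := fun a => by
    by_cases ha : a = u
    · subst ha; left; simp [State.setVert]
    · right; simp [State.setVert, ha]
  refine ⟨fun a => ?_, fun a => ?_, fun a => ?_, h.coords_wf, fun a => ?_, fun a => ?_, ?_, ?_⟩
  · rcases key a with ⟨e, rfl⟩ | ⟨e, ha⟩ <;> rw [e]
    · exact hc
    · rw [(ho a ha).1, h.ctr]
  · rcases key a with ⟨e, rfl⟩ | ⟨e, ha⟩ <;> rw [e]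
    · exact hn
    · exact h.nbrs_wf a
  · rcases key a with ⟨e, rfl⟩ | ⟨e, ha⟩ <;> rw [e]
    · exact hh
    · exact h.heap_wf a
  · rcases key a with ⟨e, rfl⟩ | ⟨e, ha⟩ <;> rw [e]
    · exact he
    · rw [(ho a ha).2.1]; exact h.ent a
  · rcases key a with ⟨e, rfl⟩ | ⟨e, ha⟩ <;> rw [e]
    · exact hq
    · rw [(ho a ha).2.1, (ho a ha).2.2]; exact h.heap a
  · rw [hcr]; exact h.crd
  · rw [hi]; exact h.inv

/-! ### The elementary operations -/

theorem Rep.ensures_pushEntry (h : Rep st m) {u v : Fin n} (hq : ¬ m.queued u v) (e : Entry) :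
    (pushEntry st u v e).Ensures fun st' t => t ≤ 1 + 2 * treeCost n ∧ Rep st' (m.push u v e) := by
  have t₁ := ((h.nbrs_wf u).balanced.insert v e).2.2.2
  have t₂ := ((h.heap_wf u).balanced.insert (toLex (e.checkpoint, v)) ()).2.2.2
  have b₁ := h.nbrs_height u
  have b₂ := h.heap_height u
  refine ensures_tick_bind (ensures_ofTimed_bind (ensures_ofTimed_bind
    (ensures_pure ⟨by omega, ?_⟩)))
  refine h.setVert u _ _ (h.ctr u) ((h.nbrs_wf u).insert _ _) ((h.heap_wf u).insert _ _)
    (fun x => ?_) (fun c x => ?_) (fun a ha => ?_) rfl rfl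
  · rw [(h.nbrs_wf u).get_insert, h.ent]
    simp [Model.push, Model.setEnt, Model.setQueued]
  · rw [(h.heap_wf u).get_insert]
    simp only [Model.push, Model.setEnt, Model.setQueued, true_and]
    by_cases hx : x = v
    · subst hx
      have := h.heap u c x
      simp only [hq, false_and, iff_false, Bool.not_eq_true, Option.isSome_eq_false_iff,
        Option.isNone_iff_eq_none] at this
      simp only [EmbeddingLike.apply_eq_iff_eq, Prod.mk.injEq, and_true, if_true, true_and,
        Option.some.injEq, exists_eq_left', this]
      split_ifs with hc
      · simp [hc]
      · simp [Ne.symm hc]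
    · simp [hx, h.heap]
  · simp [Model.push, Model.setEnt, Model.setQueued, ha]

theorem Rep.ensures_popEntry (h : Rep st m) {u v : Fin n} {e : Entry} (he : m.ent u v = some e) :
    (popEntry st u v).Ensures fun r t =>
      t ≤ 1 + 2 * treeCost n ∧ Rep r.1 (m.setQueued u v False) ∧ r.2 = e := by
  have t₁ := AVL.find?_time v (h.nbrs_wf u).balanced
  have t₂ := ((h.heap_wf u).balanced.erase (toLex (e.checkpoint, v))).2.2.2
  have b₁ := h.nbrs_height u
  have b₂ := h.heap_height u
  have hf : ((st.vert u).nbrs.find? v).val = some e := by rw [← he, ← h.ent]; rfl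
  refine ensures_tick_bind (ensures_ofTimed_bind ?_)
  rw [hf]
  refine ensures_ofTimed_bind (ensures_pure ⟨by omega, ?_, rfl⟩)
  refine h.setVert u _ _ (h.ctr u) (h.nbrs_wf u) ((h.heap_wf u).erase _)
    (fun x => h.ent u x) (fun c x => ?_) (fun a ha => ?_) rfl rfl
  · rw [(h.heap_wf u).get_erase]
    simp only [Model.setQueued, true_and]
    by_cases hx : x = v
    · subst hx
      simp only [EmbeddingLike.apply_eq_iff_eq, Prod.mk.injEq, and_true, if_true, false_and,
        iff_false]
      split_ifs with hc
      · simp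
      · rw [h.heap, he]
        rintro ⟨-, e', h1, h2⟩
        exact hc (by rw [← h2, Option.some.inj h1])
    · simp [hx, h.heap]
  · simp [Model.setQueued, ha]

theorem Rep.setCoords (h : Rep st m) {u v : Fin n} {cs : AVL (Fin n ×ₗ Fin n) Coord}
    {c : Option Coord} (hw : cs.WF)
    (hc : ∀ x, cs.get x = if x = edgeKey u v then c else st.coords.get x) :
    Rep { st with coords := cs } (m.setCrd s(u, v) c) := by
  refine ⟨h.ctr, h.nbrs_wf, h.heap_wf, hw, h.ent, h.heap, fun a b => ?_, h.inv⟩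
  simp only [hc, edgeKey_eq_iff, h.crd, Model.setCrd, Function.update_apply]

theorem Rep.ensures_setCoord (h : Rep st m) (u v : Fin n) (c : Coord) :
    (setCoord st u v c).Ensures fun st' t =>
      t ≤ 1 + treeCost n ∧ Rep st' (m.setCrd s(u, v) (some c)) := by
  have t₁ := (h.coords_wf.balanced.insert (edgeKey u v) c).2.2.2
  have b₁ := h.coords_height
  exact ensures_tick_bind (ensures_ofTimed_bind (ensures_pure ⟨by omega,
    h.setCoords (h.coords_wf.insert _ _) (h.coords_wf.get_insert _ _)⟩))

theorem Rep.ensures_startRound (h : Rep st m) {u v : Fin n} (huv : u ≠ v) (hq : ¬ m.queued u v)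
    (hq' : ¬ m.queued v u) (label : Bool) (τ : ℕ) :
    (startRound st u v label τ).Ensures fun st' t =>
      t ≤ 3 + 5 * treeCost n ∧ Rep st' (m.startRound u v label τ) := by
  refine (h.ensures_setCoord u v _).bind fun st₁ t₁ ⟨ht₁, h₁⟩ => ?_
  refine (h₁.ensures_pushEntry hq _).bind fun st₂ t₂ ⟨ht₂, h₂⟩ => ?_
  have hq₂ : ¬ ((m.setCrd s(u, v) (some ⟨label, τ, slackOf τ, 0⟩)).push u v
      ⟨(st₁.vert u).counter, (st₁.vert u).counter + slackOf τ⟩).queued v u := by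
    simp [Model.push, Model.setQueued, huv, Model.setEnt, Model.setCrd, hq']
  refine (h₂.ensures_pushEntry hq₂ _).mono fun st₃ t₃ ⟨ht₃, h₃⟩ => ⟨by omega, ?_⟩
  rw [h₁.ctr, h₂.ctr] at h₃
  exact h₃

theorem Rep.ensures_incrCounter (h : Rep st m) (u : Fin n) :
    (incrCounter st u).Ensures fun st' t => t ≤ 1 ∧ Rep st' (m.incr u) := by
  refine ensures_tick_bind (ensures_pure ⟨by omega, ?_⟩)
  refine h.setVert u _ _ (by simp [Model.incr, h.ctr]) (h.nbrs_wf u) (h.heap_wf u) (h.ent u)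
    (h.heap u) (fun a ha => by simp [Model.incr, ha]) rfl rfl

theorem Rep.setNbrs (h : Rep st m) {u v : Fin n} (hq : ¬ m.queued u v)
    {nb : AVL (Fin n) Entry} {e : Option Entry} (hw : nb.WF)
    (hnb : ∀ x, nb.get x = if x = v then e else (st.vert u).nbrs.get x) :
    Rep (st.setVert u { st.vert u with nbrs := nb }) (m.setEnt u v e) := by
  refine h.setVert u _ _ (h.ctr u) hw (h.heap_wf u) (fun x => ?_) (fun c x => ?_) (fun a ha => ?_)
    rfl rfl
  · simp [hnb, Model.setEnt, h.ent]
  · rw [h.heap]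
    by_cases hx : x = v
    · subst hx; simp [Model.setEnt, hq]
    · simp [Model.setEnt, hx]
  · simp [Model.setEnt, ha]

theorem State.vert_setVert_of_ne {u w : Fin n} (hwu : w ≠ u) (d : VertexData n) :
    (st.setVert u d).vert w = st.vert w := by simp [State.setVert, hwu]

theorem Rep.ensures_insertEdge (h : Rep st m) {u w : Fin n} (huw : u ≠ w) (hq : ¬ m.queued u w)
    (hq' : ¬ m.queued w u) :
    (insertEdge st u w).Ensures fun st' t => t ≤ 1 + 2 * treeCost n ∧
      Rep st' ((m.setEnt u w (some ⟨0, 0⟩)).setEnt w u (some ⟨0, 0⟩)) := by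
  have t₁ := ((h.nbrs_wf u).balanced.insert w ⟨0, 0⟩).2.2.2
  have t₂ := ((h.nbrs_wf w).balanced.insert u ⟨0, 0⟩).2.2.2
  have b₁ := h.nbrs_height u
  have b₂ := h.nbrs_height w
  refine ensures_tick_bind (ensures_ofTimed_bind (ensures_ofTimed_bind
    (ensures_pure ⟨by omega, ?_⟩)))
  have h₁ := h.setNbrs hq ((h.nbrs_wf u).insert w ⟨0, 0⟩) ((h.nbrs_wf u).get_insert w ⟨0, 0⟩)
  refine h₁.setNbrs hq' ((h.nbrs_wf w).insert u ⟨0, 0⟩) fun x => ?_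
  rw [State.vert_setVert_of_ne huw.symm]
  exact (h.nbrs_wf w).get_insert _ _ _

theorem Rep.ensures_deleteEdge (h : Rep st m) {u w : Fin n} (huw : u ≠ w) (hq : ¬ m.queued u w)
    (hq' : ¬ m.queued w u) :
    (deleteEdge st u w).Ensures fun st' t => t ≤ 1 + 3 * treeCost n ∧
      Rep st' (((m.setEnt u w none).setEnt w u none).setCrd s(u, w) none) := by
  have t₁ := ((h.nbrs_wf u).balanced.erase w).2.2.2
  have t₂ := ((h.nbrs_wf w).balanced.erase u).2.2.2
  have t₃ := (h.coords_wf.balanced.erase (edgeKey u w)).2.2.2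
  have b₁ := h.nbrs_height u
  have b₂ := h.nbrs_height w
  have b₃ := h.coords_height
  refine ensures_tick_bind (ensures_ofTimed_bind (ensures_ofTimed_bind (ensures_ofTimed_bind
    (ensures_pure ⟨by omega, ?_⟩))))
  have h₁ := h.setNbrs hq ((h.nbrs_wf u).erase w) ((h.nbrs_wf u).get_erase w)
  have h₂ := h₁.setNbrs (u := w) (v := u) hq' (e := none) ((h.nbrs_wf w).erase u) fun x => by
    rw [State.vert_setVert_of_ne huw.symm]
    exact (h.nbrs_wf w).get_erase _ _
  exact h₂.setCoords (h.coords_wf.erase _) (h.coords_wf.get_erase _)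

theorem Rep.ensures_memClosedNbhd (h : Rep st m) (w u : Fin n) :
    (memClosedNbhd st w u).Ensures fun _ t => t ≤ 1 + treeCost n := by
  have t₁ := AVL.find?_time w (h.nbrs_wf u).balanced
  have b₁ := h.nbrs_height u
  refine ensures_tick_bind ?_
  split_ifs
  · exact ensures_pure (by omega)
  · exact ensures_ofTimed_bind (ensures_pure (by omega))

/-- Picking a random vertex never faults: the drawn rank is at most the number of neighbours. -/
theorem Rep.ensures_pickClosedNbhd (h : Rep st m) (u : Fin n) :
    (pickClosedNbhd st u).Ensures fun _ t => t ≤ 1 + treeCost n := by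
  refine (ensures_uniform _).bind fun i t ht => ?_
  split_ifs with hi
  · exact ensures_pure (by omega)
  · have t₁ := AVL.select_time (i.val - 1) (h.nbrs_wf u).balanced
    have b₁ := h.nbrs_height u
    have hs := AVL.select_isSome (i.val - 1) (h.nbrs_wf u).balanced (by
      have := i.isLt
      simp only [State.degree] at this
      omega)
    obtain ⟨w, hw⟩ := Option.isSome_iff_exists.1 hs
    refine ensures_ofTimed_bind ?_
    rw [hw]
    exact ensures_pure (by omega)

theorem Rep.ensures_sample (h : Rep st m) (u v : Fin n) :
    (sample st u v).Ensures fun _ t => t ≤ 4 + 3 * treeCost n := by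
  refine (ensures_uniform _).bind fun _ t ht => ?_
  refine (h.ensures_pickClosedNbhd _).bind fun _ t₁ ht₁ => ?_
  refine (h.ensures_memClosedNbhd _ _).bind fun _ t₂ ht₂ => ?_
  refine (h.ensures_memClosedNbhd _ _).bind fun _ t₃ ht₃ => ?_
  exact ensures_pure (by omega)

theorem Rep.ensures_countSamples (h : Rep st m) (u v : Fin n) : ∀ L : ℕ,
    (countSamples st u v L).Ensures fun _ t => t ≤ 1 + L * (5 + 3 * treeCost n)
  | 0 => ensures_tick_bind (ensures_pure (by omega))
  | L + 1 => by
    refine ensures_tick_bind ?_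
    refine (h.ensures_sample u v).bind fun _ t₁ ht₁ => ?_
    refine (h.ensures_countSamples u v L).bind fun _ t₂ ht₂ => ?_
    exact ensures_pure (by rw [Nat.succ_mul]; omega)

theorem Rep.ensures_strategy (h : Rep st m) (ε ρ δstar : ℝ) (u v : Fin n) {L : ℕ}
    (hL : sampleSize (1 / 2 * ρ * ε) (invocationDelta δstar (m.inv + 1 : ℕ)) ≤ L) :
    (strategy ε ρ δstar st u v).Ensures fun r t =>
      t ≤ 2 + L * (5 + 3 * treeCost n) ∧ Rep r.1 { m with inv := m.inv + 1 } := by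
  refine ensures_tick_bind ?_
  refine (h.ensures_countSamples u v _).bind fun k t ht => ?_
  rw [h.inv] at ht ⊢
  have := Nat.mul_le_mul_right (5 + 3 * treeCost n) hL
  exact ensures_pure ⟨by omega,
    ⟨h.ctr, h.nbrs_wf, h.heap_wf, h.coords_wf, h.ent, h.heap, h.crd, rfl⟩⟩

end Rep

/-! ### The rounds of distributed tracking -/

theorem slackOf_pos (τ : ℕ) : 0 < slackOf τ := by
  unfold slackOf; split_ifs <;> omega

/-- The state of a round of a tracking instance: `x` and `y` are the counters of the participants,
`e` and `f` their entries, and `c` is the coordinator. The participants have signalled `a` and `b`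
times in this round, and their next signals are due one slack later. -/
structure RoundInv (x y : ℕ) (e f : Entry) (c : Coord) : Prop where
  slack : c.slack = slackOf c.tau
  signals : c.signals < if c.tau ≤ 8 then c.tau else 2
  signalled : ∃ a b, a + b = c.signals ∧
    e.checkpoint = e.sbar + (a + 1) * c.slack ∧ f.checkpoint = f.sbar + (b + 1) * c.slack ∧
    e.sbar + a * c.slack ≤ x ∧ f.sbar + b * c.slack ≤ y
  left_le : x ≤ e.checkpoint
  right_le : y ≤ f.checkpoint

section Round

variable {x y : ℕ} {e f : Entry} {c : Coord}

theorem RoundInv.symm (h : RoundInv x y e f c) : RoundInv y x f e c := by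
  obtain ⟨a, b, h₁, h₂, h₃, h₄, h₅⟩ := h.signalled
  exact ⟨h.slack, h.signals, ⟨b, a, by omega, h₃, h₂, h₅, h₄⟩, h.right_le, h.left_le⟩

theorem RoundInv.sbar_le (h : RoundInv x y e f c) : e.sbar ≤ x ∧ f.sbar ≤ y := by
  obtain ⟨a, b, h₁, h₂, h₃, h₄, h₅⟩ := h.signalled
  exact ⟨by omega, by omega⟩

theorem RoundInv.fresh (x y : ℕ) (label : Bool) {τ : ℕ} (hτ : 0 < τ) :
    RoundInv x y ⟨x, x + slackOf τ⟩ ⟨y, y + slackOf τ⟩ ⟨label, τ, slackOf τ, 0⟩ := by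
  refine ⟨rfl, ?_, ⟨0, 0, rfl, by simp, by simp, by simp, by simp⟩, Nat.le_add_right _ _,
    Nat.le_add_right _ _⟩
  dsimp only
  split_ifs <;> omega

theorem RoundInv.incr_left (h : RoundInv x y e f c) (hx : x < e.checkpoint) :
    RoundInv (x + 1) y e f c := by
  obtain ⟨a, b, h₁, h₂, h₃, h₄, h₅⟩ := h.signalled
  exact ⟨h.slack, h.signals, ⟨a, b, h₁, h₂, h₃, by omega, h₅⟩, hx, h.right_le⟩

/-- A round never counts more than its threshold plus one increments: it has at most
`signals + 2` slacks of increments, and a long round ends with its second signal. -/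
theorem RoundInv.add_le (h : RoundInv x y e f c) : x + y ≤ e.sbar + f.sbar + c.tau + 1 := by
  obtain ⟨a, b, h₁, h₂, h₃, h₄, h₅⟩ := h.signalled
  have hs := h.signals
  have hl := h.left_le
  have hr := h.right_le
  have hk := h.slack
  unfold slackOf at hk
  split_ifs at hs hk with h8
  · rw [hk] at h₂ h₃
    omega
  · have : (a + 1) * c.slack + (b + 1) * c.slack ≤ 3 * c.slack := by
      rw [← Nat.add_mul]; exact Nat.mul_le_mul_right _ (by omega)
    omega

theorem RoundInv.signal (h : RoundInv x y e f c) (hx : e.checkpoint = x)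
    (hs : c.signals + 1 < if c.tau ≤ 8 then c.tau else 2) :
    RoundInv x y { e with checkpoint := e.checkpoint + c.slack } f
      { c with signals := c.signals + 1 } := by
  obtain ⟨a, b, h₁, h₂, h₃, h₄, h₅⟩ := h.signalled
  refine ⟨h.slack, hs, ⟨a + 1, b, by simp only; omega, ?_, h₃, ?_, h₅⟩, ?_, h.right_le⟩
  · simp only [h₂]; ring
  · simp only; omega
  · simp only; omega

/-- A round whose last signal does not complete the threshold halves the remaining threshold, up to
an additive constant: at its end at least two slacks of increments have been counted. -/
theorem RoundInv.remaining (h : RoundInv x y e f c) (hx : e.checkpoint = x)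
    (hs : ¬ c.signals + 1 < if c.tau ≤ 8 then c.tau else 2)
    (hτ : c.tau - ((x - e.sbar) + (y - f.sbar)) ≠ 0) :
    8 < c.tau ∧ c.signals = 1 ∧
      Nat.log 2 (c.tau - ((x - e.sbar) + (y - f.sbar)) - 3) + 1 ≤ Nat.log 2 (c.tau - 3) := by
  obtain ⟨a, b, h₁, h₂, h₃, h₄, h₅⟩ := h.signalled
  have hs' := h.signals
  have hk := h.slack
  unfold slackOf at hk
  split_ifs at hs hs' hk with h8
  · rw [hk] at h₂ h₅
    omega
  · refine ⟨by omega, by omega, ?_⟩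
    have h2 : (a + 1) * c.slack + b * c.slack = 2 * c.slack := by
      rw [← Nat.add_mul]; congr 1; omega
    have hle : c.tau - ((x - e.sbar) + (y - f.sbar)) - 3 ≤ (c.tau - 3) / 2 := by omega
    have hpos : 1 ≤ Nat.log 2 (c.tau - 3) :=
      Nat.le_log_of_pow_le (by norm_num) (by omega)
    have := Nat.log_mono_right (b := 2) hle
    rw [Nat.log_div_base] at this
    omega

end Round

/-! ### The invariant of the data structure -/

/-- The pair `u, v` is an edge with a running tracking instance. `D` bounds the degrees, and
`κ = ρ ε / 2`: as the degrees grow only with the counters, they stay proportional to the threshold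
that was chosen when the instance was started. -/
structure EdgeInv (κ : ℝ) (D : Fin n → ℕ) (m : Model n) (u v : Fin n) (e f : Entry) (c : Coord) :
    Prop where
  ne : u ≠ v
  ent_left : m.ent u v = some e
  ent_right : m.ent v u = some f
  crd : m.crd s(u, v) = some c
  queued_left : m.queued u v
  queued_right : m.queued v u
  round : RoundInv (m.ctr u) (m.ctr v) e f c
  prog : m.ctr u + m.ctr v + m.tau0 s(u, v) = m.prog s(u, v) + c.tau + e.sbar + f.sbar
  tau0_pos : 0 < m.tau0 s(u, v)
  deg_left : κ * D u ≤ m.tau0 s(u, v) + κ * m.prog s(u, v)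
  deg_right : κ * D v ≤ m.tau0 s(u, v) + κ * m.prog s(u, v)

/-- Nothing is stored for the pair `u, v`. -/
structure NoEdge (m : Model n) (u v : Fin n) : Prop where
  ent_left : m.ent u v = none
  ent_right : m.ent v u = none
  crd : m.crd s(u, v) = none
  prog : m.prog s(u, v) = 0
  queued_left : ¬ m.queued u v
  queued_right : ¬ m.queued v u

/-- Each pair of vertices is an edge with a running tracking instance or stores nothing. -/
def Inv (κ : ℝ) (D : Fin n → ℕ) (m : Model n) : Prop :=
  ∀ u v, (∃ e f c, EdgeInv κ D m u v e f c) ∨ NoEdge m u v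

/-- No checkpoint of `u` is due. -/
def Settled (m : Model n) (u : Fin n) : Prop :=
  ∀ v e, m.ent u v = some e → m.ctr u < e.checkpoint

/-- The models agree outside the pair `p`. -/
structure AgreeOff (p : Sym2 (Fin n)) (m m' : Model n) : Prop where
  ctr : m'.ctr = m.ctr
  ent : ∀ a b, s(a, b) ≠ p → m'.ent a b = m.ent a b
  queued : ∀ a b, s(a, b) ≠ p → m'.queued a b = m.queued a b
  crd : ∀ q, q ≠ p → m'.crd q = m.crd q
  tau0 : ∀ q, q ≠ p → m'.tau0 q = m.tau0 q
  prog : ∀ q, q ≠ p → m'.prog q = m.prog q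

section Invariant

variable {κ : ℝ} {D D' : Fin n → ℕ} {m m' : Model n} {u v : Fin n} {e f : Entry} {c : Coord}

theorem EdgeInv.symm (h : EdgeInv κ D m u v e f c) : EdgeInv κ D m v u f e c := by
  have es : s(v, u) = s(u, v) := Sym2.eq_swap
  refine ⟨h.ne.symm, h.ent_right, h.ent_left, ?_, h.queued_right, h.queued_left, h.round.symm, ?_,
    ?_, ?_, ?_⟩ <;> rw [es]
  · exact h.crd
  · have := h.prog; omega
  · exact h.tau0_pos
  · exact h.deg_right
  · exact h.deg_left

theorem NoEdge.symm (h : NoEdge m u v) : NoEdge m v u := by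
  have es : s(v, u) = s(u, v) := Sym2.eq_swap
  refine ⟨h.ent_right, h.ent_left, ?_, ?_, h.queued_right, h.queued_left⟩ <;> rw [es]
  · exact h.crd
  · exact h.prog

theorem EdgeInv.of_agreeOff {p : Sym2 (Fin n)} (h : EdgeInv κ D m u v e f c)
    (hm : AgreeOff p m m') (hp : s(u, v) ≠ p) (hκ : 0 ≤ κ) (hD : ∀ a, D' a ≤ D a) :
    EdgeInv κ D' m' u v e f c := by
  have hp' : s(v, u) ≠ p := by rwa [Sym2.eq_swap]
  have mono : ∀ a, κ * (D' a : ℝ) ≤ κ * D a := fun a =>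
    mul_le_mul_of_nonneg_left (by exact_mod_cast hD a) hκ
  refine ⟨h.ne, ?_, ?_, ?_, ?_, ?_, ?_, ?_, ?_, ?_, ?_⟩
  · rw [hm.ent _ _ hp]; exact h.ent_left
  · rw [hm.ent _ _ hp']; exact h.ent_right
  · rw [hm.crd _ hp]; exact h.crd
  · rw [hm.queued _ _ hp]; exact h.queued_left
  · rw [hm.queued _ _ hp']; exact h.queued_right
  · rw [hm.ctr]; exact h.round
  · rw [hm.ctr, hm.tau0 _ hp, hm.prog _ hp]; exact h.prog
  · rw [hm.tau0 _ hp]; exact h.tau0_pos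
  · rw [hm.tau0 _ hp, hm.prog _ hp]; exact (mono u).trans h.deg_left
  · rw [hm.tau0 _ hp, hm.prog _ hp]; exact (mono v).trans h.deg_right

theorem NoEdge.of_agreeOff {p : Sym2 (Fin n)} (h : NoEdge m u v) (hm : AgreeOff p m m')
    (hp : s(u, v) ≠ p) : NoEdge m' u v := by
  have hp' : s(v, u) ≠ p := by rwa [Sym2.eq_swap]
  refine ⟨?_, ?_, ?_, ?_, ?_, ?_⟩
  · rw [hm.ent _ _ hp]; exact h.ent_left
  · rw [hm.ent _ _ hp']; exact h.ent_right
  · rw [hm.crd _ hp]; exact h.crd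
  · rw [hm.prog _ hp]; exact h.prog
  · rw [hm.queued _ _ hp]; exact h.queued_left
  · rw [hm.queued _ _ hp']; exact h.queued_right

/-- The invariant has to be checked again only for the pair that was changed. -/
theorem Inv.of_agreeOff (h : Inv κ D m) (hm : AgreeOff s(u, v) m m') (hκ : 0 ≤ κ)
    (hD : ∀ a, D' a ≤ D a) (huv : (∃ e f c, EdgeInv κ D' m' u v e f c) ∨ NoEdge m' u v) :
    Inv κ D' m' := fun a b => by
  by_cases hp : s(a, b) = s(u, v)
  · rcases Sym2.eq_iff.1 hp with ⟨rfl, rfl⟩ | ⟨rfl, rfl⟩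
    · exact huv
    · exact huv.imp (fun ⟨e, f, c, h⟩ => ⟨f, e, c, h.symm⟩) NoEdge.symm
  · exact (h a b).imp (fun ⟨e, f, c, h⟩ => ⟨e, f, c, h.of_agreeOff hm hp hκ hD⟩)
      fun h => h.of_agreeOff hm hp

theorem Inv.edge (h : Inv κ D m) (he : m.ent u v = some e) : ∃ f c, EdgeInv κ D m u v e f c := by
  rcases h u v with ⟨e', f, c, h'⟩ | h'
  · rw [h'.ent_left] at he
    obtain rfl := Option.some.inj he
    exact ⟨f, c, h'⟩
  · rw [h'.ent_left] at he; simp at he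

theorem Inv.noEdge (h : Inv κ D m) (he : m.ent u v = none) : NoEdge m u v := by
  rcases h u v with ⟨e', f, c, h'⟩ | h'
  · rw [h'.ent_left] at he; simp at he
  · exact h'

/-- The degrees stay within a constant factor of the threshold of the instance. -/
theorem EdgeInv.mul_deg_le (h : EdgeInv κ D m u v e f c) (hκ : 0 ≤ κ) (hκ' : κ ≤ 1 / 2) :
    κ * D u ≤ 2 * m.tau0 s(u, v) := by
  have h₁ := h.prog
  have h₂ := h.round.add_le
  have h₃ := h.tau0_pos
  have h₄ : (m.prog s(u, v) : ℝ) ≤ 2 * m.tau0 s(u, v) := by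
    exact_mod_cast (by omega : m.prog s(u, v) ≤ 2 * m.tau0 s(u, v))
  have h₅ := mul_le_mul_of_nonneg_left h₄ hκ
  have h₆ : κ * (2 * (m.tau0 s(u, v) : ℝ)) ≤ 1 / 2 * (2 * m.tau0 s(u, v)) :=
    mul_le_mul_of_nonneg_right hκ' (by positivity)
  linarith [h.deg_left]

end Invariant

/-! ### The potentials -/

/-- A bound for the number of signals that the instance with this coordinator can still receive
before it matures. A long round with threshold `τ` has two signals and leaves at most
`(τ - 3) / 2 + 3` for the next one; at most eight signals follow in a round with `τ ≤ 8`. -/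
def pendingSignals : Option Coord → ℕ
  | none => 0
  | some c => 2 * Nat.log 2 (c.tau - 3) + 8 - c.signals

/-- The signal potential: a bound for the number of signals that the running instances can still
receive before they mature. -/
def Model.signalPot (m : Model n) : ℕ := ∑ p, pendingSignals (m.crd p)

/-- The sum over the running instances of the fractions of their thresholds that are reached. -/
noncomputable def Model.progPot (m : Model n) : ℝ := ∑ p, (m.prog p : ℝ) / m.tau0 p

theorem Model.progPot_nonneg (m : Model n) : 0 ≤ m.progPot :=
  Finset.sum_nonneg fun _ _ => by positivity

theorem sum_add_eq_sum_add {ι M : Type*} [Fintype ι] [DecidableEq ι] [AddCommMonoid M] {f g : ι → M}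
    (p : ι) (h : ∀ q, q ≠ p → f q = g q) : ∑ q, f q + g p = ∑ q, g q + f p := by
  rw [← Finset.add_sum_erase _ f (Finset.mem_univ p),
    ← Finset.add_sum_erase _ g (Finset.mem_univ p),
    Finset.sum_congr rfl fun q hq => h q (Finset.ne_of_mem_erase hq)]
  abel

theorem AgreeOff.signalPot {p : Sym2 (Fin n)} {m m' : Model n} (h : AgreeOff p m m') :
    m'.signalPot + pendingSignals (m.crd p) = m.signalPot + pendingSignals (m'.crd p) :=
  sum_add_eq_sum_add (f := fun q => pendingSignals (m'.crd q))
    (g := fun q => pendingSignals (m.crd q)) p fun q hq => by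
    simp only [h.crd q hq]

theorem AgreeOff.progPot {p : Sym2 (Fin n)} {m m' : Model n} (h : AgreeOff p m m') :
    m'.progPot + (m.prog p : ℝ) / m.tau0 p = m.progPot + (m'.prog p : ℝ) / m'.tau0 p :=
  sum_add_eq_sum_add (f := fun q => (m'.prog q : ℝ) / m'.tau0 q)
    (g := fun q => (m.prog q : ℝ) / m.tau0 q) p fun q hq => by
    simp only [h.tau0 q hq, h.prog q hq]

/-! ### Changes of a single pair -/

section AgreeOff

variable {p : Sym2 (Fin n)} {m m' m'' : Model n} {u v : Fin n}

theorem AgreeOff.trans (h : AgreeOff p m m') (h' : AgreeOff p m' m'') : AgreeOff p m m'' :=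
  ⟨h'.ctr.trans h.ctr, fun a b hp => (h'.ent a b hp).trans (h.ent a b hp),
    fun a b hp => (h'.queued a b hp).trans (h.queued a b hp),
    fun q hq => (h'.crd q hq).trans (h.crd q hq), fun q hq => (h'.tau0 q hq).trans (h.tau0 q hq),
    fun q hq => (h'.prog q hq).trans (h.prog q hq)⟩

theorem Model.agreeOff_setEnt (m : Model n) (hp : s(u, v) = p) (e : Option Entry) :
    AgreeOff p m (m.setEnt u v e) := by
  refine ⟨rfl, fun a b hab => ?_, fun _ _ _ => rfl, fun _ _ => rfl, fun _ _ => rfl, fun _ _ => rfl⟩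
  have : ¬ (a = u ∧ b = v) := fun h => hab (by rw [h.1, h.2, hp])
  simp [Model.setEnt, this]

theorem Model.agreeOff_setQueued (m : Model n) (hp : s(u, v) = p) (q : Prop) :
    AgreeOff p m (m.setQueued u v q) := by
  refine ⟨rfl, fun _ _ _ => rfl, fun a b hab => ?_, fun _ _ => rfl, fun _ _ => rfl, fun _ _ => rfl⟩
  have : ¬ (a = u ∧ b = v) := fun h => hab (by rw [h.1, h.2, hp])
  simp [Model.setQueued, this]

theorem Model.agreeOff_setCrd (m : Model n) (c : Option Coord) : AgreeOff p m (m.setCrd p c) :=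
  ⟨rfl, fun _ _ _ => rfl, fun _ _ _ => rfl, fun _ hq => Function.update_of_ne hq _ _,
    fun _ _ => rfl, fun _ _ => rfl⟩

theorem Model.agreeOff_push (m : Model n) (hp : s(u, v) = p) (e : Entry) :
    AgreeOff p m (m.push u v e) :=
  (m.agreeOff_setEnt hp _).trans (Model.agreeOff_setQueued _ hp _)

theorem Model.agreeOff_startRound (m : Model n) (u v : Fin n) (label : Bool) (τ : ℕ) :
    AgreeOff s(u, v) m (m.startRound u v label τ) :=
  ((m.agreeOff_setCrd _).trans (Model.agreeOff_push _ rfl _)).trans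
    (Model.agreeOff_push _ Sym2.eq_swap _)

/-- Count an invocation of the labelling strategy, and start to track the edge `p` anew with
threshold `τ`. -/
def Model.restart (m : Model n) (p : Sym2 (Fin n)) (τ : ℕ) : Model n :=
  { m with
    inv := m.inv + 1
    tau0 := Function.update m.tau0 p τ
    prog := Function.update m.prog p 0 }

theorem Model.agreeOff_restart (m : Model n) (τ : ℕ) : AgreeOff p m (m.restart p τ) :=
  ⟨rfl, fun _ _ _ => rfl, fun _ _ _ => rfl, fun _ _ => rfl,
    fun _ hq => Function.update_of_ne hq _ _, fun _ hq => Function.update_of_ne hq _ _⟩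

end AgreeOff

/-- The fields of a model that are not stored in memory are irrelevant for the representation. -/
theorem Rep.of_eq {st : State n} {m m' : Model n} (h : Rep st m) (h₁ : m'.ctr = m.ctr)
    (h₂ : m'.ent = m.ent) (h₃ : m'.queued = m.queued) (h₄ : m'.crd = m.crd)
    (h₅ : m'.inv = m.inv) : Rep st m' :=
  ⟨by rw [h₁]; exact h.ctr, h.nbrs_wf, h.heap_wf, h.coords_wf, by rw [h₂]; exact h.ent,
    by rw [h₂, h₃]; exact h.heap, by rw [h₄]; exact h.crd, by rw [h₅]; exact h.inv⟩

/-- A new round continues a tracking instance whose increments and remaining threshold add up to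
the original threshold. -/
theorem Model.edgeInv_startRound {κ : ℝ} {D : Fin n → ℕ} {m : Model n} {u v : Fin n} (huv : u ≠ v)
    (label : Bool) {τ : ℕ} (hτ : 0 < τ) (hprog : m.tau0 s(u, v) = m.prog s(u, v) + τ)
    (hu : κ * D u ≤ m.tau0 s(u, v) + κ * m.prog s(u, v))
    (hv : κ * D v ≤ m.tau0 s(u, v) + κ * m.prog s(u, v)) :
    EdgeInv κ D (m.startRound u v label τ) u v ⟨m.ctr u, m.ctr u + slackOf τ⟩
      ⟨m.ctr v, m.ctr v + slackOf τ⟩ ⟨label, τ, slackOf τ, 0⟩ := by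
  refine ⟨huv, ?_, ?_, ?_, ?_, ?_, RoundInv.fresh _ _ _ hτ, ?_, ?_, hu, hv⟩
  · simp [startRound, push, setEnt, setQueued, setCrd, huv]
  · simp [startRound, push, setEnt, setQueued, setCrd]
  · simp [startRound, push, setEnt, setQueued, setCrd]
  · simp [startRound, push, setEnt, setQueued, setCrd]
  · simp [startRound, push, setEnt, setQueued, setCrd]
  · simp only [startRound, push, setEnt, setQueued, setCrd, hprog]; omega
  · simp only [startRound, push, setEnt, setQueued, setCrd, hprog]; omega

theorem Model.edgeInv_restart {κ : ℝ} (hκ : 0 ≤ κ) {D : Fin n → ℕ} {m : Model n} {u v : Fin n}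
    (huv : u ≠ v) (label : Bool) {τ : ℕ} (hτ : τ = ⌊κ * (max (D u) (D v) : ℕ)⌋₊ + 1) :
    EdgeInv κ D ((m.restart s(u, v) τ).startRound u v label τ) u v
      ⟨m.ctr u, m.ctr u + slackOf τ⟩ ⟨m.ctr v, m.ctr v + slackOf τ⟩ ⟨label, τ, slackOf τ, 0⟩ := by
  have key : κ * (max (D u) (D v) : ℕ) ≤ τ := by
    rw [hτ]; push_cast; exact (Nat.lt_floor_add_one _).le
  have mono : ∀ d, d ≤ max (D u) (D v) → κ * (d : ℝ) ≤ τ := fun d hd =>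
    (mul_le_mul_of_nonneg_left (by exact_mod_cast hd) hκ).trans key
  refine edgeInv_startRound huv label (by omega) (by simp [restart]) ?_ ?_
  · simpa [restart] using mono _ (le_max_left _ _)
  · simpa [restart] using mono _ (le_max_right _ _)

/-! ### Processing a due checkpoint -/

/-- What happens while due checkpoints are processed: the graph stays the same, new checkpoints are
not due, and each invocation of the labelling strategy is paid for by the progress potential. -/
structure Evolves (m m' : Model n) : Prop where
  ctr : m'.ctr = m.ctr
  adj : ∀ a b, (m'.ent a b).isSome = (m.ent a b).isSome
  later : ∀ a b e, m'.ent a b = some e → m.ent a b = some e ∨ m.ctr a < e.checkpoint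
  budget : m'.inv + m'.progPot ≤ m.inv + m.progPot

section Evolves

variable {m m' m'' : Model n} {u v : Fin n} {e f e' f' : Entry}

theorem Evolves.refl (m : Model n) : Evolves m m :=
  ⟨rfl, fun _ _ => rfl, fun _ _ _ => Or.inl, le_rfl⟩

theorem Evolves.trans (h : Evolves m m') (h' : Evolves m' m'') : Evolves m m'' :=
  ⟨h'.ctr.trans h.ctr, fun a b => (h'.adj a b).trans (h.adj a b), fun a b e he => by
    rcases h'.later a b e he with h₁ | h₁
    · exact h.later a b e h₁
    · rw [h.ctr] at h₁; exact Or.inr h₁, h'.budget.trans h.budget⟩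

theorem Evolves.deg (h : Evolves m m') : m'.deg = m.deg := by
  funext a
  simp only [Model.deg, h.adj]

theorem Evolves.settled (h : Evolves m m') (hs : Settled m u) : Settled m' u := fun v e he => by
  rw [h.ctr]
  rcases h.later u v e he with h₁ | h₁
  · exact hs v e h₁
  · exact h₁

/-- The neighbours `v` of `u` for which the checkpoint of the edge `(u, v)` at `u` is due. -/
noncomputable def Model.due (m : Model n) (u : Fin n) : Finset (Fin n) :=
  open scoped Classical in
  Finset.univ.filter fun v => ∃ e, m.ent u v = some e ∧ e.checkpoint = m.ctr u

theorem Model.mem_due : v ∈ m.due u ↔ ∃ e, m.ent u v = some e ∧ e.checkpoint = m.ctr u := by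
  simp [Model.due]

theorem Evolves.due_ssubset (h : Evolves m m') (hv : v ∈ m.due u)
    (hv' : ∀ e, m'.ent u v = some e → m.ctr u < e.checkpoint) : m'.due u ⊂ m.due u := by
  refine (Finset.ssubset_iff_of_subset fun w hw => ?_).2 ⟨v, hv, fun hw => ?_⟩
  · obtain ⟨e, he, hx⟩ := Model.mem_due.1 hw
    rw [h.ctr] at hx
    rcases h.later u w e he with h₁ | h₁
    · exact Model.mem_due.2 ⟨e, h₁, hx⟩
    · omega
  · obtain ⟨e, he, hx⟩ := Model.mem_due.1 hw
    have := hv' e he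
    rw [h.ctr] at hx
    omega

theorem AgreeOff.evolves (h : AgreeOff s(u, v) m m') (he : m.ent u v = some e)
    (hf : m.ent v u = some f) (he' : m'.ent u v = some e') (hf' : m'.ent v u = some f')
    (hx : m.ctr u < e'.checkpoint) (hy : f' = f ∨ m.ctr v < f'.checkpoint)
    (hb : m'.inv + m'.progPot ≤ m.inv + m.progPot) : Evolves m m' := by
  refine ⟨h.ctr, fun a b => ?_, fun a b g hg => ?_, hb⟩
  · by_cases hp : s(a, b) = s(u, v)
    · rcases Sym2.eq_iff.1 hp with ⟨rfl, rfl⟩ | ⟨rfl, rfl⟩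
      · rw [he, he']; rfl
      · rw [hf, hf']; rfl
    · rw [h.ent a b hp]
  · by_cases hp : s(a, b) = s(u, v)
    · rcases Sym2.eq_iff.1 hp with ⟨rfl, rfl⟩ | ⟨rfl, rfl⟩
      · rw [he'] at hg
        obtain rfl := Option.some.inj hg
        exact Or.inr hx
      · rw [hf'] at hg
        obtain rfl := Option.some.inj hg
        exact hy.imp_left fun hy => by rw [hf, hy]
    · left; rwa [h.ent a b hp] at hg

end Evolves

/-- The number of steps charged to an invocation of the labelling strategy that draws at most `L`
samples: it pays for the labelling, for restarting the tracking instance and, in advance, for all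
signals of the restarted instance. -/
def relabelCost (n L : ℕ) : ℕ :=
  30 * treeCost n + L * (5 + 3 * treeCost n) + 20 * treeCost n * (2 * Nat.log 2 n + 8)

theorem two_le_treeCost (n : ℕ) : 2 ≤ treeCost n := by unfold treeCost; omega

theorem Model.deg_le (m : Model n) (u : Fin n) : m.deg u ≤ n :=
  (Finset.card_le_univ _).trans (Fintype.card_fin n).le

/-- The thresholds are at most `n + 1`, hence a new instance receives `O(log n)` signals. -/
theorem pendingSignals_threshold_le {κ : ℝ} (hκ : κ ≤ 1) (m : Model n) (u v : Fin n) (label : Bool)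
    {τ : ℕ} (hτ : τ = ⌊κ * (max (m.deg u) (m.deg v) : ℕ)⌋₊ + 1) :
    pendingSignals (some ⟨label, τ, slackOf τ, 0⟩) ≤ 2 * Nat.log 2 n + 8 := by
  have h₁ : ⌊κ * (max (m.deg u) (m.deg v) : ℕ)⌋₊ ≤ n := by
    refine Nat.floor_le_of_le ?_
    have : ((max (m.deg u) (m.deg v) : ℕ) : ℝ) ≤ n := by
      exact_mod_cast max_le (m.deg_le u) (m.deg_le v)
    nlinarith [Nat.cast_nonneg (α := ℝ) (max (m.deg u) (m.deg v))]
  have h₂ : Nat.log 2 (τ - 3) ≤ Nat.log 2 n := Nat.log_mono_right (by omega)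
  simp only [pendingSignals]
  omega

section Due

variable {ε ρ δstar I : ℝ} {L : ℕ} {st : State n} {m : Model n} {u v : Fin n}

theorem Rep.threshold_eq (h : Rep st m) (ε ρ : ℝ) (u v : Fin n) :
    threshold ε ρ st u v = ⌊1 / 2 * ρ * ε * (max (m.deg u) (m.deg v) : ℕ)⌋₊ + 1 := by
  rw [threshold, h.degree, h.degree]

theorem Rep.ensures_relabel (h : Rep st m) (huv : u ≠ v) (hq : ¬ m.queued u v)
    (hq' : ¬ m.queued v u)
    (hL : sampleSize (1 / 2 * ρ * ε) (invocationDelta δstar (m.inv + 1 : ℕ)) ≤ L)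
    (F : List (Fin n × Fin n)) (label : Bool) :
    (relabel ε ρ δstar st F u v label).Ensures fun r t =>
      t ≤ 5 + 5 * treeCost n + L * (5 + 3 * treeCost n) ∧ ∃ label' τ,
        τ = ⌊1 / 2 * ρ * ε * (max (m.deg u) (m.deg v) : ℕ)⌋₊ + 1 ∧
        Rep r.1 ((m.restart s(u, v) τ).startRound u v label' τ) := by
  refine (h.ensures_strategy ε ρ δstar u v hL).bind ?_
  rintro ⟨st₁, label'⟩ t₁ ⟨ht₁, h₁⟩
  have hτ := h₁.threshold_eq ε ρ u v
  refine (h₁.ensures_startRound huv hq hq' label' _).bind fun st₂ t₂ ⟨ht₂, h₂⟩ => ?_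
  refine ensures_pure ⟨by omega, label', _, hτ, ?_⟩
  exact h₂.of_eq rfl rfl rfl rfl rfl

/-- The amortized cost of processing a due checkpoint is zero: a signal that does not mature the
instance consumes one of its pending signals, and a maturing one is paid for by the invocation. -/
theorem Rep.ensures_processEntry (hκ : 0 ≤ 1 / 2 * ρ * ε) (hκ' : 1 / 2 * ρ * ε ≤ 1)
    (hL : ∀ i : ℕ, 1 ≤ i → (i : ℝ) ≤ I →
      sampleSize (1 / 2 * ρ * ε) (invocationDelta δstar i) ≤ L)
    (h : Rep st m) (hi : Inv (1 / 2 * ρ * ε) m.deg m) (hI : m.inv + m.progPot ≤ I)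
    (F : List (Fin n × Fin n)) (hv : v ∈ m.due u) :
    (processEntry ε ρ δstar st F u v).Ensures fun r t => ∃ m', Rep r.1 m' ∧
      Inv (1 / 2 * ρ * ε) m'.deg m' ∧ Evolves m m' ∧ m'.due u ⊂ m.due u ∧
      t + (1 + treeCost n) + 20 * treeCost n * m'.signalPot + relabelCost n L * m.inv ≤
        20 * treeCost n * m.signalPot + relabelCost n L * m'.inv := by
  obtain ⟨e, he, hx⟩ := Model.mem_due.1 hv
  obtain ⟨f, c, E⟩ := hi.edge he
  have huv := E.ne
  have hH := two_le_treeCost n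
  have hag : AgreeOff s(u, v) m (m.setQueued u v False) := m.agreeOff_setQueued rfl _
  refine (h.ensures_popEntry he).bind ?_
  rintro ⟨st₁, e₁⟩ t₁ ⟨ht₁, h₁, he₁⟩
  obtain rfl : e₁ = e := he₁
  refine ensures_ofTimed_bind ?_
  have ht₂ := AVL.find?_time (edgeKey u v) h₁.coords_wf.balanced
  have hh₂ := h₁.coords_height
  have hc : (st₁.coords.find? (edgeKey u v)).val = some c := (h₁.crd u v).trans E.crd
  rw [hc]
  dsimp only at h₁ ht₂ hh₂ ⊢
  by_cases hs : c.signals + 1 < if c.tau ≤ 8 then c.tau else 2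
  · -- the round goes on
    rw [if_pos hs]
    refine (h₁.ensures_setCoord u v _).bind fun st₃ t₃ ⟨ht₃, h₃⟩ => ?_
    have hq₃ : ¬ ((m.setQueued u v False).setCrd s(u, v)
        (some { c with signals := c.signals + 1 })).queued u v := by
      simp [Model.setQueued, Model.setCrd]
    refine (h₃.ensures_pushEntry hq₃ _).bind fun st₄ t₄ ⟨ht₄, h₄⟩ => ?_
    refine ensures_pure ⟨_, h₄, ?_⟩
    set m' := ((m.setQueued u v False).setCrd s(u, v)
      (some { c with signals := c.signals + 1 })).push u v
        { e₁ with checkpoint := e₁.checkpoint + c.slack } with hm'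
    have hA : AgreeOff s(u, v) m m' :=
      (hag.trans (Model.agreeOff_setCrd _ _)).trans (Model.agreeOff_push _ rfl _)
    have hcr : m'.crd s(u, v) = some { c with signals := c.signals + 1 } := by
      simp [hm', Model.push, Model.setEnt, Model.setQueued, Model.setCrd]
    have E' : EdgeInv (1 / 2 * ρ * ε) m.deg m' u v
        { e₁ with checkpoint := e₁.checkpoint + c.slack } f
        { c with signals := c.signals + 1 } := by
      refine ⟨huv, ?_, ?_, hcr, ?_, ?_, E.round.signal hx hs, E.prog, E.tau0_pos, E.deg_left,
        E.deg_right⟩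
      · simp [hm', Model.push, Model.setEnt, Model.setQueued]
      · rw [← E.ent_right]
        simp [hm', Model.push, Model.setEnt, Model.setQueued, huv, Model.setCrd]
      · simp [hm', Model.push, Model.setEnt, Model.setQueued]
      · have := E.queued_right
        simpa [hm', Model.push, Model.setEnt, Model.setQueued, huv, Model.setCrd] using this
    have hslack : 0 < c.slack := E.round.slack ▸ slackOf_pos _
    have hlt : m.ctr u < e₁.checkpoint + c.slack := by omega
    have hev : Evolves m m' := hA.evolves he E.ent_right E'.ent_left E'.ent_right hlt (Or.inl rfl)
      (le_of_eq (by rfl))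
    refine ⟨?_, hev, hev.due_ssubset hv fun e' h' => ?_, ?_⟩
    · rw [hev.deg]
      exact hi.of_agreeOff hA hκ (fun _ => le_rfl) (Or.inl ⟨_, _, _, E'⟩)
    · rw [E'.ent_left] at h'
      rw [← Option.some.inj h']
      exact hlt
    · have hP := hA.signalPot
      rw [hcr, E.crd] at hP
      simp only [pendingSignals] at hP
      have hlim := E.round.signals
      have hP' : m'.signalPot + 1 ≤ m.signalPot := by split_ifs at hs hlim <;> omega
      have := Nat.mul_le_mul_left (20 * treeCost n) hP'
      have hinv : m'.inv = m.inv := rfl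
      rw [hinv]
      rw [Nat.mul_add] at this
      omega
  · rw [if_neg hs]
    have hf : (m.setQueued u v False).ent v u = some f := E.ent_right
    refine (h₁.ensures_popEntry hf).bind ?_
    rintro ⟨st₃, f₃⟩ t₃ ⟨ht₃, h₃, hf₃⟩
    obtain rfl : f₃ = f := hf₃
    dsimp only at h₃ ⊢
    set m₃ := (m.setQueued u v False).setQueued v u False with hm₃
    have hag₃ : AgreeOff s(u, v) m m₃ := hag.trans (Model.agreeOff_setQueued _ Sym2.eq_swap _)
    have hq₃ : ¬ m₃.queued u v := by simp [hm₃, Model.setQueued]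
    have hq₃' : ¬ m₃.queued v u := by simp [hm₃, Model.setQueued]
    rw [h₃.ctr, h₃.ctr]
    have hcu : m₃.ctr = m.ctr := rfl
    rw [hcu]
    obtain ⟨hsb, hsb'⟩ := E.round.sbar_le
    have hprog := E.prog
    split_ifs with hτ
    · -- the instance matures: all of its threshold is reached
      have hge : m.tau0 s(u, v) ≤ m.prog s(u, v) := by omega
      have hone : (1 : ℝ) ≤ (m.prog s(u, v) : ℝ) / m.tau0 s(u, v) := by
        rw [one_le_div (by exact_mod_cast E.tau0_pos)]
        exact_mod_cast hge
      have hpot : ∀ m' : Model n, AgreeOff s(u, v) m m' → m'.prog s(u, v) = 0 →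
          m'.progPot + 1 ≤ m.progPot := fun m' hA h0 => by
        have := hA.progPot
        rw [h0] at this
        simp only [Nat.cast_zero, zero_div, add_zero] at this
        linarith
      have hI' : ((m.inv + 1 : ℕ) : ℝ) ≤ I := by
        have := hpot (m.restart s(u, v) 0) (m.agreeOff_restart _) (by simp [Model.restart])
        have := (m.restart s(u, v) 0).progPot_nonneg
        push_cast
        linarith
      refine (h₃.ensures_relabel huv hq₃ hq₃' (hL _ (by omega) hI') F c.label).mono ?_
      rintro ⟨st₄, F'⟩ t₄ ⟨ht₄, label', τ, hτ', h₄⟩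
      have hdeg : m₃.deg = m.deg := rfl
      rw [hdeg] at hτ'
      refine ⟨_, h₄, ?_⟩
      set m' := (m₃.restart s(u, v) τ).startRound u v label' τ with hm'
      have E' : EdgeInv (1 / 2 * ρ * ε) m.deg m' u v _ _ _ :=
        Model.edgeInv_restart (m := m₃) hκ huv label' hτ'
      have hA : AgreeOff s(u, v) m m' :=
        (hag₃.trans (Model.agreeOff_restart _ _)).trans (Model.agreeOff_startRound _ _ _ _ _)
      have h0 : m'.prog s(u, v) = 0 := by
        change (m₃.restart s(u, v) τ).prog s(u, v) = 0
        simp [Model.restart]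
      have hinv : m'.inv = m.inv + 1 := rfl
      have hsl := slackOf_pos τ
      have hlt : m.ctr u < m₃.ctr u + slackOf τ := by rw [hcu]; omega
      have hev : Evolves m m' := hA.evolves he E.ent_right E'.ent_left E'.ent_right hlt
        (Or.inr (by rw [hcu]; dsimp only; omega)) (by
          have := hpot m' hA h0
          rw [hinv]; push_cast; linarith)
      refine ⟨?_, hev, hev.due_ssubset hv fun e' h' => ?_, ?_⟩
      · rw [hev.deg]
        exact hi.of_agreeOff hA hκ (fun _ => le_rfl) (Or.inl ⟨_, _, _, E'⟩)
      · rw [E'.ent_left] at h'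
        rw [← Option.some.inj h']
        exact hlt
      · have hP := hA.signalPot
        rw [E'.crd] at hP
        have hps := pendingSignals_threshold_le hκ' m u v label' hτ'
        have hP' : m'.signalPot ≤ m.signalPot + (2 * Nat.log 2 n + 8) := by omega
        have := Nat.mul_le_mul_left (20 * treeCost n) hP'
        rw [hinv]
        rw [Nat.mul_add] at this
        rw [Nat.mul_add, Nat.mul_one]
        unfold relabelCost
        omega
    · -- a new round with the remaining threshold
      refine (h₃.ensures_startRound huv hq₃ hq₃' c.label _).bind fun st₄ t₄ ⟨ht₄, h₄⟩ => ?_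
      obtain ⟨h8, hs1, hlog⟩ := E.round.remaining hx hs hτ
      set τ := c.tau - ((m.ctr u - e₁.sbar) + (m.ctr v - f₃.sbar)) with hτ'
      refine ensures_pure ⟨_, h₄, ?_⟩
      set m' := m₃.startRound u v c.label τ with hm'
      have hA : AgreeOff s(u, v) m m' := hag₃.trans (Model.agreeOff_startRound _ _ _ _ _)
      have E' : EdgeInv (1 / 2 * ρ * ε) m.deg m' u v _ _ _ :=
        Model.edgeInv_startRound (m := m₃) huv c.label (Nat.pos_of_ne_zero hτ)
          (by change m.tau0 _ = m.prog _ + τ; omega) E.deg_left E.deg_right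
      have hinv : m'.inv = m.inv := rfl
      have hsl := slackOf_pos τ
      have hlt : m.ctr u < m₃.ctr u + slackOf τ := by rw [hcu]; omega
      have hev : Evolves m m' := hA.evolves he E.ent_right E'.ent_left E'.ent_right hlt
        (Or.inr (by rw [hcu]; dsimp only; omega)) (le_of_eq (by rfl))
      refine ⟨?_, hev, hev.due_ssubset hv fun e' h' => ?_, ?_⟩
      · rw [hev.deg]
        exact hi.of_agreeOff hA hκ (fun _ => le_rfl) (Or.inl ⟨_, _, _, E'⟩)
      · rw [E'.ent_left] at h'
        rw [← Option.some.inj h']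
        exact hlt
      · have hP := hA.signalPot
        rw [E'.crd, E.crd] at hP
        simp only [pendingSignals] at hP
        have hP' : m'.signalPot + 1 ≤ m.signalPot := by omega
        have := Nat.mul_le_mul_left (20 * treeCost n) hP'
        rw [hinv]
        rw [Nat.mul_add] at this
        omega

theorem Rep.mem_due_of_min? (h : Rep st m) {p : ℕ ×ₗ Fin n}
    (hp : (st.vert u).dtHeap.min?.val = some p) (hx : (ofLex p).1 = m.ctr u) :
    (ofLex p).2 ∈ m.due u := by
  obtain ⟨⟨_, hy⟩, -⟩ := (h.heap_wf u).min?_eq_some hp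
  obtain ⟨-, e, he, hc⟩ := (h.heap u (ofLex p).1 (ofLex p).2).1
    (Option.isSome_iff_exists.2 ⟨_, hy⟩)
  exact Model.mem_due.2 ⟨e, he, hc.trans hx⟩

theorem Rep.get_dtHeap (h : Rep st m) {κ : ℝ} {D : Fin n → ℕ} (hi : Inv κ D m) {e : Entry}
    (he : m.ent u v = some e) : ∃ y, (st.vert u).dtHeap.get (toLex (e.checkpoint, v)) = some y := by
  obtain ⟨f, c, E⟩ := hi.edge he
  exact Option.isSome_iff_exists.1 ((h.heap u _ v).2 ⟨E.queued_left, e, he, rfl⟩)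

theorem Rep.settled_of_min?_eq_none (h : Rep st m) {κ : ℝ} {D : Fin n → ℕ} (hi : Inv κ D m)
    (hp : (st.vert u).dtHeap.min?.val = none) : Settled m u := fun v e he => by
  obtain ⟨y, hy⟩ := h.get_dtHeap hi he
  rw [(h.heap_wf u).min?_eq_none hp] at hy
  simp at hy

theorem Rep.settled_of_min?_ne (h : Rep st m) {κ : ℝ} {D : Fin n → ℕ} (hi : Inv κ D m)
    {p : ℕ ×ₗ Fin n} (hp : (st.vert u).dtHeap.min?.val = some p)
    (hx : (ofLex p).1 ≠ m.ctr u) : Settled m u := fun v e he => by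
  obtain ⟨y, hy⟩ := h.get_dtHeap hi he
  obtain ⟨⟨_, hy'⟩, hmin⟩ := (h.heap_wf u).min?_eq_some hp
  obtain ⟨-, e', he', hc'⟩ := (h.heap u (ofLex p).1 (ofLex p).2).1
    (Option.isSome_iff_exists.2 ⟨_, hy'⟩)
  obtain ⟨f, c, E⟩ := hi.edge he'
  have h₁ := E.round.left_le
  have h₂ := Prod.Lex.le_iff.1 (hmin _ _ hy)
  simp only [ofLex_toLex] at h₂
  omega

/-- Draining the priority queue of `u` takes at most one iteration for each due checkpoint, and
leaves none due. -/
theorem Rep.ensures_drain (hκ : 0 ≤ 1 / 2 * ρ * ε) (hκ' : 1 / 2 * ρ * ε ≤ 1)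
    (hL : ∀ i : ℕ, 1 ≤ i → (i : ℝ) ≤ I →
      sampleSize (1 / 2 * ρ * ε) (invocationDelta δstar i) ≤ L) (u : Fin n) (fuel : ℕ) :
    ∀ {st : State n} {m : Model n} (F : List (Fin n × Fin n)), Rep st m →
      Inv (1 / 2 * ρ * ε) m.deg m → m.inv + m.progPot ≤ I → (m.due u).card ≤ fuel →
    (drain ε ρ δstar u fuel st F).Ensures fun r t => ∃ m', Rep r.1 m' ∧
      Inv (1 / 2 * ρ * ε) m'.deg m' ∧ Evolves m m' ∧ Settled m' u ∧
      t + 20 * treeCost n * m'.signalPot + relabelCost n L * m.inv ≤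
        (1 + treeCost n) + 20 * treeCost n * m.signalPot + relabelCost n L * m'.inv := by
  induction fuel with
  | zero =>
    intro st m F h hi hI hd
    have ht := AVL.min?_time (h.heap_wf u).balanced
    have hh := h.heap_height u
    rw [drain]
    refine ensures_tick_bind (ensures_ofTimed_bind ?_)
    rcases hp : (st.vert u).dtHeap.min?.val with _ | p
    · exact ensures_pure ⟨m, h, hi, Evolves.refl m, h.settled_of_min?_eq_none hi hp, by omega⟩
    · dsimp only
      split_ifs with hx
      · rw [h.ctr] at hx
        have := Finset.card_pos.2 ⟨_, h.mem_due_of_min? hp hx⟩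
        omega
      · rw [h.ctr] at hx
        exact ensures_pure ⟨m, h, hi, Evolves.refl m, h.settled_of_min?_ne hi hp hx, by omega⟩
  | succ fuel ih =>
    intro st m F h hi hI hd
    have ht := AVL.min?_time (h.heap_wf u).balanced
    have hh := h.heap_height u
    rw [drain]
    refine ensures_tick_bind (ensures_ofTimed_bind ?_)
    rcases hp : (st.vert u).dtHeap.min?.val with _ | p
    · exact ensures_pure ⟨m, h, hi, Evolves.refl m, h.settled_of_min?_eq_none hi hp, by omega⟩
    · dsimp only
      split_ifs with hx
      · rw [h.ctr] at hx
        refine (h.ensures_processEntry hκ hκ' hL hi hI F (h.mem_due_of_min? hp hx)).bind ?_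
        rintro ⟨st₁, F₁⟩ t₁ ⟨m₁, h₁, hi₁, hev₁, hd₁, ht₁⟩
        have hcard := Finset.card_lt_card hd₁
        refine (ih F₁ h₁ hi₁ (hev₁.budget.trans hI) (by omega)).mono ?_
        rintro r t₂ ⟨m₂, h₂, hi₂, hev₂, hs₂, ht₂⟩
        exact ⟨m₂, h₂, hi₂, hev₁.trans hev₂, hs₂, by omega⟩
      · rw [h.ctr] at hx
        exact ensures_pure ⟨m, h, hi, Evolves.refl m, h.settled_of_min?_ne hi hp hx, by omega⟩

end Due

/-! ### Counter increments -/

/-- Increment the counter of `u`, which counts as an increment for all instances of edges at `u`. -/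
def Model.advance (m : Model n) (u : Fin n) : Model n :=
  { m.incr u with prog := fun p => if u ∈ p ∧ (m.crd p).isSome then m.prog p + 1 else m.prog p }

section Advance

variable {κ : ℝ} {D : Fin n → ℕ} {m : Model n} {u v w : Fin n}

theorem EdgeInv.advance_left {e f : Entry} {c : Coord} (h : EdgeInv κ D m u v e f c)
    (hκ : 0 ≤ κ) (hs : m.ctr u < e.checkpoint) :
    EdgeInv κ (Function.update D u (D u + 1)) (m.advance u) u v e f c := by
  have hp : (m.advance u).prog s(u, v) = m.prog s(u, v) + 1 := by
    simp [Model.advance, h.crd]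
  have hu : (m.advance u).ctr u = m.ctr u + 1 := by simp [Model.advance, Model.incr]
  have hv : (m.advance u).ctr v = m.ctr v := by simp [Model.advance, Model.incr, h.ne.symm]
  have ht : (m.advance u).tau0 s(u, v) = m.tau0 s(u, v) := rfl
  refine ⟨h.ne, h.ent_left, h.ent_right, h.crd, h.queued_left, h.queued_right, ?_, ?_, h.tau0_pos,
    ?_, ?_⟩
  · rw [hu, hv]; exact h.round.incr_left hs
  · rw [hu, hv, hp, ht]; have := h.prog; omega
  · rw [hp, ht, Function.update_self]
    push_cast
    linarith [h.deg_left]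
  · rw [hp, ht, Function.update_of_ne h.ne.symm]
    push_cast
    linarith [h.deg_right]

theorem EdgeInv.advance_of_ne {e f : Entry} {c : Coord} (h : EdgeInv κ D m v w e f c)
    (hv : v ≠ u) (hw : w ≠ u) :
    EdgeInv κ (Function.update D u (D u + 1)) (m.advance u) v w e f c := by
  have hp : (m.advance u).prog s(v, w) = m.prog s(v, w) := by
    simp [Model.advance, hv.symm, hw.symm]
  have hv' : (m.advance u).ctr v = m.ctr v := by simp [Model.advance, Model.incr, hv]
  have hw' : (m.advance u).ctr w = m.ctr w := by simp [Model.advance, Model.incr, hw]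
  have ht : (m.advance u).tau0 s(v, w) = m.tau0 s(v, w) := rfl
  refine ⟨h.ne, h.ent_left, h.ent_right, h.crd, h.queued_left, h.queued_right, ?_, ?_, h.tau0_pos,
    ?_, ?_⟩
  · rw [hv', hw']; exact h.round
  · rw [hv', hw', hp, ht]; exact h.prog
  · rw [hp, ht, Function.update_of_ne hv]; exact h.deg_left
  · rw [hp, ht, Function.update_of_ne hw]; exact h.deg_right

/-- The increment leaves room for one more neighbour of `u`. -/
theorem Inv.advance (h : Inv κ D m) (hκ : 0 ≤ κ) (hs : Settled m u) :
    Inv κ (Function.update D u (D u + 1)) (m.advance u) := fun a b => by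
  rcases h a b with ⟨e, f, c, E⟩ | N
  · by_cases ha : a = u
    · subst ha
      exact Or.inl ⟨e, f, c, E.advance_left hκ (hs b e E.ent_left)⟩
    · by_cases hb : b = u
      · subst hb
        exact Or.inl ⟨e, f, c, (E.symm.advance_left hκ (hs a f E.ent_right)).symm⟩
      · exact Or.inl ⟨e, f, c, E.advance_of_ne ha hb⟩
  · refine Or.inr ⟨N.ent_left, N.ent_right, N.crd, ?_, N.queued_left, N.queued_right⟩
    simp [Model.advance, N.crd, N.prog]

/-- An increment at `u` raises the progress of each of the at most `D u` instances of edges at `u`,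
all with thresholds proportional to `D u`, so the progress potential grows by a constant. -/
theorem Inv.progPot_advance_le (h : Inv κ D m) (hκ : 0 < κ) (hκ' : κ ≤ 1 / 2)
    (hD : m.deg u ≤ D u) : (m.advance u).progPot ≤ m.progPot + 2 / κ := by
  classical
  set S : Finset (Sym2 (Fin n)) :=
    (Finset.univ.filter fun v => (m.ent u v).isSome).image fun v => s(u, v) with hS
  have hcard : S.card ≤ D u := Finset.card_image_le.trans hD
  have hmem : ∀ p, u ∈ p ∧ (m.crd p).isSome → p ∈ S := by
    rintro p ⟨hu, hp⟩
    obtain ⟨v, rfl⟩ := hu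
    rcases h u v with ⟨e, f, c, E⟩ | N
    · exact Finset.mem_image.2 ⟨v, by simp [E.ent_left], rfl⟩
    · simp [N.crd] at hp
  have hterm : ∀ p, ((m.advance u).prog p : ℝ) / (m.advance u).tau0 p ≤
      (m.prog p : ℝ) / m.tau0 p + if p ∈ S then 1 / (m.tau0 p : ℝ) else 0 := fun p => by
    change (((if u ∈ p ∧ (m.crd p).isSome then m.prog p + 1 else m.prog p : ℕ) : ℝ)) / m.tau0 p ≤ _
    split_ifs with h₁ h₂ h₂
    · push_cast; rw [add_div]
    · exact absurd (hmem p h₁) h₂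
    · have : (0 : ℝ) ≤ 1 / m.tau0 p := by positivity
      linarith
    · simp
  have hsum : (m.advance u).progPot ≤ m.progPot + ∑ p ∈ S, 1 / (m.tau0 p : ℝ) := by
    have := Finset.sum_le_sum fun p (_ : p ∈ Finset.univ) => hterm p
    rw [Finset.sum_add_distrib, Finset.sum_ite_mem, Finset.univ_inter] at this
    exact this
  have hS' : ∑ p ∈ S, 1 / (m.tau0 p : ℝ) ≤ 2 / κ := by
    rcases Nat.eq_zero_or_pos (D u) with h0 | hpos
    · have : S = ∅ := Finset.card_eq_zero.1 (by omega)
      rw [this, Finset.sum_empty]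
      positivity
    · have hpos' : (0 : ℝ) < D u := by exact_mod_cast hpos
      have hle : ∀ p ∈ S, 1 / (m.tau0 p : ℝ) ≤ 2 / (κ * D u) := fun p hp => by
        obtain ⟨v, hv, rfl⟩ := Finset.mem_image.1 hp
        obtain ⟨e, he⟩ := Option.isSome_iff_exists.1 (Finset.mem_filter.1 hv).2
        obtain ⟨f, c, E⟩ := h.edge he
        have h₁ : (0 : ℝ) < m.tau0 s(u, v) := by exact_mod_cast E.tau0_pos
        rw [div_le_div_iff₀ h₁ (by positivity)]
        linarith [E.mul_deg_le hκ.le hκ']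
      refine (Finset.sum_le_card_nsmul _ _ _ hle).trans ?_
      rw [nsmul_eq_mul]
      have : (S.card : ℝ) * (2 / (κ * D u)) ≤ D u * (2 / (κ * D u)) :=
        mul_le_mul_of_nonneg_right (by exact_mod_cast hcard) (by positivity)
      refine this.trans (le_of_eq ?_)
      field_simp
  linarith

theorem Settled.advance_of_ne (h : Settled m v) (hv : v ≠ u) : Settled (m.advance u) v :=
  fun w e he => by
    have := h w e he
    simpa [Model.advance, Model.incr, hv] using this

theorem Rep.ensures_advance {st : State n} (h : Rep st m) (u : Fin n) :
    (incrCounter st u).Ensures fun st' t => t ≤ 1 ∧ Rep st' (m.advance u) :=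
  (h.ensures_incrCounter u).mono fun _ _ h' => ⟨h'.1, h'.2.of_eq rfl rfl rfl rfl rfl⟩

end Advance

/-! ### Updates -/

/-- The update inserts a new edge or deletes an existing one. -/
def Update.ValidIn (G : SimpleGraph (Fin n)) : Update n → Prop
  | .insert u w => u ≠ w ∧ ¬ G.Adj u w
  | .delete u w => G.Adj u w

/-- The graph after the update. -/
def Update.apply (G : SimpleGraph (Fin n)) : Update n → SimpleGraph (Fin n)
  | .insert u w => G ⊔ SimpleGraph.edge u w
  | .delete u w => G.deleteEdges {s(u, w)}

theorem validFrom_cons {G : SimpleGraph (Fin n)} {up : Update n} {ups : List (Update n)} :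
    ValidFrom G (up :: ups) ↔ up.ValidIn G ∧ ValidFrom (up.apply G) ups := by
  cases up <;> simp [ValidFrom, Update.ValidIn, Update.apply, and_assoc]

theorem Model.deg_congr {m m' : Model n} (h : ∀ a b, (m'.ent a b).isSome = (m.ent a b).isSome) :
    m'.deg = m.deg := by
  funext a
  simp only [Model.deg, h]

theorem Model.deg_setEnt_le (m : Model n) (u v : Fin n) (e : Option Entry) (a : Fin n) :
    (m.setEnt u v e).deg a ≤ m.deg a + if a = u then 1 else 0 := by
  classical
  split_ifs with ha
  · refine (Finset.card_le_card (t := insert v (Finset.univ.filter fun b => (m.ent a b).isSome))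
      fun b hb => ?_).trans (Finset.card_insert_le _ _)
    simp only [Finset.mem_insert, Finset.mem_filter, Finset.mem_univ, true_and] at hb ⊢
    by_cases hbv : b = v
    · exact Or.inl hbv
    · right; simpa [Model.setEnt, hbv] using hb
  · refine Finset.card_le_card (t := Finset.univ.filter fun b => (m.ent a b).isSome) fun b hb => ?_
    simpa [Model.setEnt, ha] using hb

theorem Model.deg_setEnt_none_le (m : Model n) (u v : Fin n) (a : Fin n) :
    (m.setEnt u v none).deg a ≤ m.deg a := by
  refine Finset.card_le_card fun b hb => ?_
  rw [Finset.mem_filter] at hb ⊢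
  have h := hb.2
  simp only [Model.setEnt] at h
  split_ifs at h
  · simp at h
  · exact ⟨Finset.mem_univ _, h⟩

section Update

variable {ε ρ δstar I : ℝ} {L : ℕ} {st : State n} {m : Model n} {u w : Fin n} {D : Fin n → ℕ}
  {G : SimpleGraph (Fin n)}

/-- What holds after the edge of an update has been inserted or deleted, before the priority queues
are drained. Here `G` is the new graph, and `t` the number of steps taken since the state with the
content `m`. -/
structure Stepped (κ : ℝ) (G : SimpleGraph (Fin n)) (L : ℕ) (m : Model n) (st' : State n) (t : ℕ)
    (m' : Model n) : Prop where
  rep : Rep st' m'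
  inv : Inv κ m'.deg m'
  adj : ∀ a b, G.Adj a b ↔ (m'.ent a b).isSome
  settled : ∀ x, Settled m x → Settled m' x
  budget : m'.inv + m'.progPot ≤ m.inv + m.progPot + 1
  time : t + 20 * treeCost n * m'.signalPot + relabelCost n L * m.inv ≤
    10 * treeCost n + 20 * treeCost n * m.signalPot + relabelCost n L * m'.inv

theorem Rep.ensures_stepInsert (hκ : 0 ≤ 1 / 2 * ρ * ε) (hκ' : 1 / 2 * ρ * ε ≤ 1)
    (hL : sampleSize (1 / 2 * ρ * ε) (invocationDelta δstar (m.inv + 1 : ℕ)) ≤ L)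
    (h : Rep st m) (hi : Inv (1 / 2 * ρ * ε) D m) (hG : ∀ a b, G.Adj a b ↔ (m.ent a b).isSome)
    (huw : u ≠ w) (hadj : ¬ G.Adj u w)
    (hD : ∀ a, m.deg a + (if a = u then 1 else 0) + (if a = w then 1 else 0) ≤ D a) :
    (stepInsert ε ρ δstar st u w).Ensures fun r t => ∃ m',
      Stepped (1 / 2 * ρ * ε) (G ⊔ SimpleGraph.edge u w) L m r.1 t m' := by
  have hH := two_le_treeCost n
  have N : NoEdge m u w := hi.noEdge (by
    rw [hG, Bool.not_eq_true, Option.isSome_eq_false_iff, Option.isNone_iff_eq_none] at hadj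
    exact hadj)
  refine (h.ensures_insertEdge huw N.queued_left N.queued_right).bind fun st₁ t₁ ⟨ht₁, h₁⟩ => ?_
  set m₁ := (m.setEnt u w (some ⟨0, 0⟩)).setEnt w u (some ⟨0, 0⟩) with hm₁
  have hA₁ : AgreeOff s(u, w) m m₁ :=
    (m.agreeOff_setEnt rfl _).trans (Model.agreeOff_setEnt _ Sym2.eq_swap _)
  refine (h₁.ensures_strategy ε ρ δstar u w hL).bind ?_
  rintro ⟨st₂, label⟩ t₂ ⟨ht₂, h₂⟩
  have hτ := h₂.threshold_eq ε ρ u w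
  refine (h₂.ensures_startRound huw N.queued_left N.queued_right label _).bind
    fun st₃ t₃ ⟨ht₃, h₃⟩ => ?_
  set τ := threshold ε ρ st₂ u w
  have hdeg₁ : ({ m₁ with inv := m₁.inv + 1 } : Model n).deg = m₁.deg := rfl
  rw [hdeg₁] at hτ
  set m' := (m₁.restart s(u, w) τ).startRound u w label τ with hm'
  have E' : EdgeInv (1 / 2 * ρ * ε) m₁.deg m' u w _ _ _ :=
    Model.edgeInv_restart (m := m₁) hκ huw label hτ
  have hA : AgreeOff s(u, w) m m' :=
    (hA₁.trans (Model.agreeOff_restart _ _)).trans (Model.agreeOff_startRound _ _ _ _ _)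
  have hent : ∀ a b, s(a, b) = s(u, w) → (m'.ent a b).isSome ∧ (m₁.ent a b).isSome ∧
      ∀ e, m'.ent a b = some e → m.ctr a < e.checkpoint := fun a b hab => by
    have hsl := slackOf_pos τ
    rcases Sym2.eq_iff.1 hab with ⟨rfl, rfl⟩ | ⟨rfl, rfl⟩
    · rw [E'.ent_left]
      refine ⟨rfl, by simp [hm₁, Model.setEnt], fun e he => ?_⟩
      rw [← Option.some.inj he]
      exact Nat.lt_add_of_pos_right hsl
    · rw [E'.ent_right]
      refine ⟨rfl, by simp [hm₁, Model.setEnt], fun e he => ?_⟩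
      rw [← Option.some.inj he]
      exact Nat.lt_add_of_pos_right hsl
  have hdeg : m'.deg = m₁.deg := Model.deg_congr fun a b => by
    by_cases hab : s(a, b) = s(u, w)
    · obtain ⟨h₁, h₂, -⟩ := hent a b hab
      rw [h₁, h₂]
    · rw [hA.ent a b hab, hA₁.ent a b hab]
  have h0 : m'.prog s(u, w) = 0 := by
    change (m₁.restart s(u, w) τ).prog s(u, w) = 0
    simp [Model.restart]
  have hinv : m'.inv = m.inv + 1 := rfl
  refine ensures_pure ⟨m', h₃.of_eq rfl rfl rfl rfl rfl, ?_, fun a b => ?_, fun x hx b e he => ?_,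
    ?_, ?_⟩
  · rw [hdeg]
    refine hi.of_agreeOff hA hκ (fun a => ?_) (Or.inl ⟨_, _, _, E'⟩)
    have e₁ := m.deg_setEnt_le u w (some ⟨0, 0⟩) a
    have e₂ := (m.setEnt u w (some ⟨0, 0⟩)).deg_setEnt_le w u (some ⟨0, 0⟩) a
    rw [← hm₁] at e₂
    have := hD a
    omega
  · rw [SimpleGraph.sup_adj, SimpleGraph.edge_adj]
    by_cases hab : s(a, b) = s(u, w)
    · refine iff_of_true (Or.inr ?_) (hent a b hab).1
      rcases Sym2.eq_iff.1 hab with ⟨rfl, rfl⟩ | ⟨rfl, rfl⟩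
      · exact ⟨Or.inl ⟨rfl, rfl⟩, huw⟩
      · exact ⟨Or.inr ⟨rfl, rfl⟩, huw.symm⟩
    · rw [hA.ent a b hab, hG, ← Sym2.eq_iff.trans Iff.rfl]
      simp [hab]
  · rw [hA.ctr]
    by_cases hxb : s(x, b) = s(u, w)
    · exact (hent x b hxb).2.2 e he
    · rw [hA.ent x b hxb] at he
      exact hx b e he
  · have hp := hA.progPot
    rw [h0, N.prog] at hp
    simp only [Nat.cast_zero, zero_div, add_zero] at hp
    rw [hinv, hp]
    push_cast
    linarith
  · have hP := hA.signalPot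
    rw [E'.crd, N.crd] at hP
    have hps := pendingSignals_threshold_le hκ' m₁ u w label hτ
    have hP' : m'.signalPot ≤ m.signalPot + (2 * Nat.log 2 n + 8) := by
      simp only [pendingSignals] at hP hps
      omega
    have := Nat.mul_le_mul_left (20 * treeCost n) hP'
    rw [hinv]
    rw [Nat.mul_add] at this
    rw [Nat.mul_add, Nat.mul_one]
    unfold relabelCost
    omega

theorem Rep.ensures_stepDelete {κ : ℝ} (hκ : 0 ≤ κ) (h : Rep st m) (hi : Inv κ D m)
    (hG : ∀ a b, G.Adj a b ↔ (m.ent a b).isSome) (hadj : G.Adj u w) (hD : ∀ a, m.deg a ≤ D a) :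
    (stepDelete st u w).Ensures fun r t => ∃ m',
      Stepped κ (G.deleteEdges {s(u, w)}) L m r.1 t m' := by
  have hH := two_le_treeCost n
  obtain ⟨e, he⟩ := Option.isSome_iff_exists.1 ((hG u w).1 hadj)
  obtain ⟨f, c, E⟩ := hi.edge he
  have huw := E.ne
  have ht₀ := AVL.find?_time (edgeKey u w) h.coords_wf.balanced
  have hh₀ := h.coords_height
  have hc : (st.coords.find? (edgeKey u w)).val = some c := (h.crd u w).trans E.crd
  refine ensures_ofTimed_bind ?_
  rw [hc]
  refine (h.ensures_popEntry he).bind ?_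
  rintro ⟨st₁, e₁⟩ t₁ ⟨ht₁, h₁, -⟩
  have hf : (m.setQueued u w False).ent w u = some f := E.ent_right
  refine (h₁.ensures_popEntry hf).bind ?_
  rintro ⟨st₂, e₂⟩ t₂ ⟨ht₂, h₂, -⟩
  dsimp only at h₂ ⊢
  set m₂ := (m.setQueued u w False).setQueued w u False with hm₂
  refine (h₂.ensures_deleteEdge huw (by simp [hm₂, Model.setQueued])
    (by simp [hm₂, Model.setQueued])).bind fun st₃ t₃ ⟨ht₃, h₃⟩ => ?_
  set m₃ := ((m₂.setEnt u w none).setEnt w u none).setCrd s(u, w) none with hm₃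
  set m' : Model n := { m₃ with prog := Function.update m₃.prog s(u, w) 0 } with hm'
  have hA : AgreeOff s(u, w) m m' :=
    (((((m.agreeOff_setQueued rfl _).trans (Model.agreeOff_setQueued _ Sym2.eq_swap _)).trans
      (Model.agreeOff_setEnt _ rfl _)).trans (Model.agreeOff_setEnt _ Sym2.eq_swap _)).trans
      (Model.agreeOff_setCrd _ _)).trans
      ⟨rfl, fun _ _ _ => rfl, fun _ _ _ => rfl, fun _ _ => rfl, fun _ _ => rfl,
        fun _ hq => Function.update_of_ne hq _ _⟩
  have N : NoEdge m' u w := by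
    refine ⟨?_, ?_, ?_, ?_, ?_, ?_⟩ <;>
      simp [hm', hm₃, hm₂, Model.setEnt, Model.setCrd, Model.setQueued]
  have hent : ∀ a b, s(a, b) = s(u, w) → m'.ent a b = none := fun a b hab => by
    rcases Sym2.eq_iff.1 hab with ⟨rfl, rfl⟩ | ⟨rfl, rfl⟩
    · exact N.ent_left
    · exact N.ent_right
  have hinv : m'.inv = m.inv := rfl
  refine ensures_pure ⟨m', h₃.of_eq rfl rfl rfl rfl rfl, ?_, fun a b => ?_, fun x hx b e he => ?_,
    ?_, ?_⟩
  · refine hi.of_agreeOff hA hκ (fun a => ?_) (Or.inr N)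
    have e₁ := m₂.deg_setEnt_none_le u w a
    have e₂ := (m₂.setEnt u w none).deg_setEnt_none_le w u a
    exact (e₂.trans e₁).trans (hD a)
  · rw [SimpleGraph.deleteEdges_adj, Set.mem_singleton_iff]
    by_cases hab : s(a, b) = s(u, w)
    · simp [hab, hent a b hab]
    · rw [hA.ent a b hab, hG]
      simp [hab]
  · rw [hA.ctr]
    by_cases hxb : s(x, b) = s(u, w)
    · rw [hent x b hxb] at he; simp at he
    · rw [hA.ent x b hxb] at he
      exact hx b e he
  · have hp := hA.progPot
    rw [N.prog] at hp
    simp only [Nat.cast_zero, zero_div, add_zero] at hp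
    have : (0 : ℝ) ≤ (m.prog s(u, w) : ℝ) / m.tau0 s(u, w) := by positivity
    rw [hinv]
    linarith
  · have hP := hA.signalPot
    rw [N.crd] at hP
    simp only [pendingSignals] at hP
    have hP' : m'.signalPot ≤ m.signalPot := by omega
    have := Nat.mul_le_mul_left (20 * treeCost n) hP'
    rw [hinv]
    omega

/-- The state between two updates: it represents the graph `G`, and no checkpoint is due. -/
structure Stable (κ : ℝ) (G : SimpleGraph (Fin n)) (st : State n) (m : Model n) : Prop where
  rep : Rep st m
  inv : Inv κ m.deg m
  adj : ∀ a b, G.Adj a b ↔ (m.ent a b).isSome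
  settled : ∀ x, Settled m x

theorem Stepped.ensures_drain (hκ : 0 ≤ 1 / 2 * ρ * ε) (hκ' : 1 / 2 * ρ * ε ≤ 1)
    (hL : ∀ i : ℕ, 1 ≤ i → (i : ℝ) ≤ I →
      sampleSize (1 / 2 * ρ * ε) (invocationDelta δstar i) ≤ L)
    {st' : State n} {t : ℕ} {m' : Model n} (h : Stepped (1 / 2 * ρ * ε) G L m st' t m')
    (hI : m.inv + m.progPot + 1 ≤ I) (hs : ∀ x, x ≠ u → x ≠ w → Settled m x)
    (F : List (Fin n × Fin n)) :
    (drain ε ρ δstar u n st' F >>= fun r => drain ε ρ δstar w n r.1 r.2).Ensures fun r s =>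
      ∃ m'', Stable (1 / 2 * ρ * ε) G r.1 m'' ∧
        m''.inv + m''.progPot ≤ m.inv + m.progPot + 1 ∧
        t + s + 20 * treeCost n * m''.signalPot + relabelCost n L * m.inv ≤
          (12 * treeCost n + 2) + 20 * treeCost n * m.signalPot + relabelCost n L * m''.inv := by
  have hdue : ∀ (m : Model n) x, (m.due x).card ≤ n := fun m x =>
    (Finset.card_le_univ _).trans (Fintype.card_fin n).le
  have ht := h.time
  have hb := h.budget
  refine (h.rep.ensures_drain hκ hκ' hL u n F h.inv (hb.trans hI) (hdue _ _)).bind ?_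
  rintro ⟨st₁, F₁⟩ t₁ ⟨m₁, h₁, hi₁, hev₁, hs₁, ht₁⟩
  have hb₁ := hev₁.budget
  refine (h₁.ensures_drain hκ hκ' hL w n F₁ hi₁ ((hb₁.trans hb).trans hI) (hdue _ _)).mono ?_
  rintro r t₂ ⟨m₂, h₂, hi₂, hev₂, hs₂, ht₂⟩
  refine ⟨m₂, ⟨h₂, hi₂, fun a b => ?_, fun x => ?_⟩, (hev₂.budget.trans hb₁).trans hb, by omega⟩
  · rw [hev₂.adj, hev₁.adj]; exact h.adj a b
  · by_cases hxw : x = w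
    · rw [hxw]; exact hs₂
    · by_cases hxu : x = u
      · rw [hxu]; exact hev₂.settled hs₁
      · exact hev₂.settled (hev₁.settled (h.settled x (hs x hxu hxw)))

/-- The amortized cost of one update. The progress potential grows by `2 / κ` for each of the two
counter increments, and inserting an edge adds one invocation of the labelling strategy. -/
theorem Stable.ensures_update (hκ : 0 < 1 / 2 * ρ * ε) (hκ' : 1 / 2 * ρ * ε ≤ 1 / 2)
    (hL : ∀ i : ℕ, 1 ≤ i → (i : ℝ) ≤ I →
      sampleSize (1 / 2 * ρ * ε) (invocationDelta δstar i) ≤ L)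
    (h : Stable (1 / 2 * ρ * ε) G st m)
    (hI : m.inv + m.progPot + (4 / (1 / 2 * ρ * ε) + 1) ≤ I) {up : Update n}
    (hup : up.ValidIn G) :
    (update ε ρ δstar st up).Ensures fun r t =>
      ∃ m', Stable (1 / 2 * ρ * ε) (up.apply G) r.1 m' ∧
        m'.inv + m'.progPot ≤ m.inv + m.progPot + (4 / (1 / 2 * ρ * ε) + 1) ∧
        t + 20 * treeCost n * m'.signalPot + relabelCost n L * m.inv ≤
          20 * treeCost n + 20 * treeCost n * m.signalPot + relabelCost n L * m'.inv := by
  have hκ'' : 1 / 2 * ρ * ε ≤ 1 := hκ'.trans (by norm_num)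
  have hH := two_le_treeCost n
  obtain ⟨u, w, huw, hend⟩ : ∃ u w, u ≠ w ∧ up.endpoints = (u, w) := by
    cases up with
    | insert u w => exact ⟨u, w, hup.1, rfl⟩
    | delete u w => exact ⟨u, w, SimpleGraph.Adj.ne hup, rfl⟩
  unfold update
  rw [hend]
  refine (h.rep.ensures_advance u).bind fun st₁ t₁ ⟨ht₁, h₁⟩ => ?_
  refine (h₁.ensures_advance w).bind fun st₂ t₂ ⟨ht₂, h₂⟩ => ?_
  have hi₁ := h.inv.advance hκ.le (h.settled u)
  have hp₁ := h.inv.progPot_advance_le hκ hκ' (u := u) le_rfl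
  have hs₁ : ∀ x, x ≠ u → Settled (m.advance u) x := fun x hx => (h.settled x).advance_of_ne hx
  have hi₂ := hi₁.advance hκ.le (hs₁ w huw.symm)
  have hp₂ := hi₁.progPot_advance_le hκ hκ' (u := w) (by
    rw [Function.update_of_ne huw.symm]; exact le_rfl)
  set m₂ := (m.advance u).advance w with hm₂
  have hs₂ : ∀ x, x ≠ u → x ≠ w → Settled m₂ x := fun x hu hw => (hs₁ x hu).advance_of_ne hw
  have hadj₂ : ∀ a b, G.Adj a b ↔ (m₂.ent a b).isSome := h.adj
  have hinv₂ : m₂.inv = m.inv := rfl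
  have hsig₂ : m₂.signalPot = m.signalPot := rfl
  have hsplit : 2 / (1 / 2 * ρ * ε) + 2 / (1 / 2 * ρ * ε) = 4 / (1 / 2 * ρ * ε) := by ring
  have hI₂ : m₂.inv + m₂.progPot + 1 ≤ I := by rw [hinv₂]; linarith
  have hD : ∀ a, m₂.deg a + (if a = u then 1 else 0) + (if a = w then 1 else 0) ≤
      Function.update (Function.update m.deg u (m.deg u + 1)) w
        (Function.update m.deg u (m.deg u + 1) w + 1) a := fun a => by
    have : m₂.deg a = m.deg a := rfl
    simp only [Function.update_apply, this]
    split_ifs <;> simp_all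
  have hfinish : ∀ p : Rand (State n × List (Fin n × Fin n)),
      (p.Ensures fun r t => ∃ m', Stepped (1 / 2 * ρ * ε) (up.apply G) L m₂ r.1 t m') →
      (p >>= fun r => drain ε ρ δstar u n r.1 r.2 >>= fun r =>
        drain ε ρ δstar w n r.1 r.2).Ensures fun r s =>
      ∃ m', Stable (1 / 2 * ρ * ε) (up.apply G) r.1 m' ∧
        m'.inv + m'.progPot ≤ m.inv + m.progPot + (4 / (1 / 2 * ρ * ε) + 1) ∧
        t₁ + (t₂ + s) + 20 * treeCost n * m'.signalPot + relabelCost n L * m.inv ≤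
          20 * treeCost n + 20 * treeCost n * m.signalPot + relabelCost n L * m'.inv := by
    intro p hp
    refine hp.bind ?_
    rintro ⟨st₃, F⟩ t₃ ⟨m₃, h₃⟩
    refine (h₃.ensures_drain (u := u) (w := w) hκ.le hκ'' hL hI₂ hs₂ F).mono ?_
    rintro r t₄ ⟨m₄, h₄, hb₄, ht₄⟩
    refine ⟨m₄, h₄, ?_, ?_⟩
    · rw [hinv₂] at hb₄; linarith
    · rw [hinv₂, hsig₂] at ht₄; omega
  cases up with
  | insert u' w' =>
    obtain ⟨rfl, rfl⟩ := Prod.mk.inj hend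
    refine hfinish _ (h₂.ensures_stepInsert hκ.le hκ'' (hL _ (by omega) ?_) hi₂ hadj₂ huw hup.2 hD)
    have := m₂.progPot_nonneg
    push_cast
    linarith
  | delete u' w' =>
    obtain ⟨rfl, rfl⟩ := Prod.mk.inj hend
    exact hfinish _ (h₂.ensures_stepDelete hκ.le hi₂ hadj₂ hup fun a => by have := hD a; omega)

theorem Stable.ensures_runFrom (hκ : 0 < 1 / 2 * ρ * ε) (hκ' : 1 / 2 * ρ * ε ≤ 1 / 2)
    (hL : ∀ i : ℕ, 1 ≤ i → (i : ℝ) ≤ I →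
      sampleSize (1 / 2 * ρ * ε) (invocationDelta δstar i) ≤ L) (ups : List (Update n)) :
    ∀ {G : SimpleGraph (Fin n)} {st : State n} {m : Model n}, Stable (1 / 2 * ρ * ε) G st m →
      ValidFrom G ups →
      m.inv + m.progPot + (4 / (1 / 2 * ρ * ε) + 1) * ups.length ≤ I →
    (runFrom ε ρ δstar st ups).Ensures fun _ t => ∃ m' : Model n,
        m'.inv + m'.progPot ≤ m.inv + m.progPot + (4 / (1 / 2 * ρ * ε) + 1) * ups.length ∧
        t + relabelCost n L * m.inv ≤
          20 * treeCost n * ups.length + 20 * treeCost n * m.signalPot +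
            relabelCost n L * m'.inv := by
  induction ups with
  | nil =>
    intro G st m h hv hI
    exact ensures_pure ⟨m, by simp, by simp⟩
  | cons up ups ih =>
    intro G st m h hv hI
    obtain ⟨hup, hv⟩ := validFrom_cons.1 hv
    have hpos : 0 < 4 / (1 / 2 * ρ * ε) + 1 := by positivity
    set C := 4 / (1 / 2 * ρ * ε) + 1
    rw [List.length_cons] at hI ⊢
    push_cast at hI ⊢
    have hnn : 0 ≤ C * (ups.length : ℝ) := by positivity
    refine (h.ensures_update hκ hκ' hL (by linarith) hup).bind ?_
    rintro ⟨st₁, F⟩ t₁ ⟨m₁, h₁, hb₁, ht₁⟩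
    refine (ih h₁ hv (by linarith)).mono ?_
    rintro _ t₂ ⟨m₂, hb₂, ht₂⟩
    refine ⟨m₂, by linarith, ?_⟩
    rw [Nat.mul_add, Nat.mul_one]
    omega

end Update

/-- If the sample sizes of the first `(4 / κ + 1) M` invocations are at most `L`, then `M` updates
take at most `M (20 H + (4 / κ + 1) R)` steps, where `H` is the cost of a search tree operation and
`R` the cost charged to an invocation. -/
theorem ensures_run {ε ρ δstar : ℝ} {L : ℕ} (hκ : 0 < 1 / 2 * ρ * ε)
    (hκ' : 1 / 2 * ρ * ε ≤ 1 / 2) {ups : List (Update n)} (hv : ValidFrom ⊥ ups)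
    (hL : ∀ i : ℕ, 1 ≤ i → (i : ℝ) ≤ (4 / (1 / 2 * ρ * ε) + 1) * ups.length →
      sampleSize (1 / 2 * ρ * ε) (invocationDelta δstar i) ≤ L) :
    (run ε ρ δstar ups).Ensures fun _ t => (t : ℝ) ≤ ups.length *
      (20 * treeCost n + (4 / (1 / 2 * ρ * ε) + 1) * relabelCost n L) := by
  have h₀ : Stable (n := n) (1 / 2 * ρ * ε) ⊥ (State.empty n) ⟨fun _ => 0, fun _ _ => none,
      fun _ _ => False, fun _ => none, 0, fun _ => 0, fun _ => 0⟩ :=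
    ⟨Rep.empty, fun u v => Or.inr ⟨rfl, rfl, rfl, rfl, id, id⟩, fun a b => by simp,
      fun x v e he => by simp at he⟩
  refine (h₀.ensures_runFrom hκ hκ' hL ups hv (by simp [Model.progPot])).mono ?_
  rintro _ t ⟨m', hb, ht⟩
  have hs : (⟨fun _ => 0, fun _ _ => none, fun _ _ => False, fun _ => none, 0, fun _ => 0,
      fun _ => 0⟩ : Model n).signalPot = 0 := by simp [Model.signalPot, pendingSignals]
  rw [hs] at ht
  have hp := m'.progPot_nonneg
  simp only [Model.progPot, Nat.cast_zero, zero_div, Finset.sum_const_zero, zero_add] at hb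
  have hinv : (m'.inv : ℝ) ≤ (4 / (1 / 2 * ρ * ε) + 1) * ups.length :=
    le_trans (le_add_of_nonneg_right hp) hb
  have ht' : (t : ℝ) ≤ 20 * treeCost n * ups.length + relabelCost n L * m'.inv := by
    have : t ≤ 20 * treeCost n * ups.length + relabelCost n L * m'.inv := by simpa using ht
    exact_mod_cast this
  have := mul_le_mul_of_nonneg_left hinv (Nat.cast_nonneg (α := ℝ) (relabelCost n L))
  linarith

/-! ### Logarithmic bounds -/

theorem half_le_log {n : ℕ} (hn : 2 ≤ n) : 1 / 2 ≤ Real.log n := by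
  have h₁ : Real.log 2 ≤ Real.log n :=
    Real.log_le_log (by norm_num) (by exact_mod_cast hn)
  linarith [Real.log_two_gt_d9]

theorem natLog_two_le (x : ℕ) : (Nat.log 2 x : ℝ) ≤ 2 * Real.log x := by
  have h₁ := Real.natLog_le_logb x 2
  have h₂ : Real.logb (2 : ℕ) x ≤ 2 * Real.log x := by
    rw [Real.logb, Nat.cast_two, div_le_iff₀ (Real.log_pos (by norm_num))]
    have := Real.log_natCast_nonneg x
    nlinarith [Real.log_two_gt_d9]
  exact h₁.trans h₂

theorem treeCost_le {n : ℕ} (hn : 2 ≤ n) : (treeCost n : ℝ) ≤ 16 * Real.log n := by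
  have h₁ := natLog_two_le (n * n + 1)
  have h₂ : Real.log (n * n + 1 : ℕ) ≤ 3 * Real.log n := by
    rw [show (3 : ℝ) = (3 : ℕ) by norm_num, ← Real.log_pow]
    refine Real.log_le_log (by positivity) ?_
    have : n * n + 1 ≤ n ^ 3 := by nlinarith
    exact_mod_cast this
  have h₃ := half_le_log hn
  unfold treeCost
  push_cast at h₁ h₂ ⊢
  linarith

/-- Charging `O(log n)` samples to an invocation makes its cost `O(log² n)`. -/
theorem relabelCost_le {n L : ℕ} {C : ℝ} (hn : 2 ≤ n) (hL : (L : ℝ) ≤ C * Real.log n) :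
    (relabelCost n L : ℝ) ≤ (7400 + 58 * C) * Real.log n ^ 2 := by
  have h₁ := treeCost_le hn
  have h₂ := natLog_two_le n
  have h₃ := half_le_log hn
  have hH := Nat.cast_nonneg (α := ℝ) (treeCost n)
  unfold relabelCost
  push_cast
  set H : ℝ := (treeCost n : ℝ)
  set l := Real.log n
  have a₁ : 30 * H ≤ 960 * l ^ 2 := by nlinarith
  have a₂ : (L : ℝ) * (5 + 3 * H) ≤ C * l * (58 * l) :=
    mul_le_mul hL (by linarith) (by positivity) ((Nat.cast_nonneg _).trans hL)
  have a₃ : 20 * H * (2 * (Nat.log 2 n : ℝ) + 8) ≤ 20 * (16 * l) * (20 * l) :=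
    mul_le_mul (by linarith) (by linarith) (by positivity) (by positivity)
  nlinarith

/-- The first `B * M` invocations, where `M ≤ A n ^ c`, draw `O(log n)` samples each. -/
theorem log_two_div_invocationDelta_le {n i : ℕ} {A B c M : ℝ} (hn : 2 ≤ n) (hi : 1 ≤ i)
    (hA : 0 < A) (hB : 0 < B) (hM : M ≤ A * (n : ℝ) ^ c) (hiM : (i : ℝ) ≤ B * M) :
    Real.log (2 / invocationDelta (1 / (n : ℝ)) i) ≤
      (3 + 4 * |Real.log (B * A)| + 2 * |c|) * Real.log n := by
  have hl := half_le_log hn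
  have hn0 : (0 : ℝ) < n := by exact_mod_cast (by omega : 0 < n)
  have hi0 : (1 : ℝ) ≤ i := by exact_mod_cast hi
  have hn2 : (2 : ℝ) ≤ n := by exact_mod_cast hn
  have e₁ : 2 / invocationDelta (1 / (n : ℝ)) i = 2 * n * (i * (i + 1)) := by
    unfold invocationDelta
    field_simp
  have e₂ : 2 * (n : ℝ) * (i * (i + 1)) ≤ n ^ 3 * (i : ℝ) ^ 2 := by
    have h₁ : (i : ℝ) * (i + 1) ≤ 2 * i ^ 2 := by nlinarith
    have h₂ : (2 : ℝ) * 2 ≤ n * n := mul_le_mul hn2 hn2 (by norm_num) hn0.le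
    calc 2 * (n : ℝ) * (i * (i + 1)) ≤ 2 * n * (2 * i ^ 2) :=
          mul_le_mul_of_nonneg_left h₁ (by positivity)
      _ = (2 * 2) * (n * (i : ℝ) ^ 2) := by ring
      _ ≤ (n * n) * (n * (i : ℝ) ^ 2) := mul_le_mul_of_nonneg_right h₂ (by positivity)
      _ = n ^ 3 * (i : ℝ) ^ 2 := by ring
  have e₃ : Real.log (2 * n * (i * (i + 1))) ≤ 3 * Real.log n + 2 * Real.log i := by
    refine (Real.log_le_log (by positivity) e₂).trans (le_of_eq ?_)
    rw [Real.log_mul (by positivity) (by positivity), Real.log_pow, Real.log_pow]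
    norm_num
  have e₄ : Real.log i ≤ Real.log (B * A) + c * Real.log n := by
    have hle : (i : ℝ) ≤ B * A * (n : ℝ) ^ c := by
      rw [mul_assoc]
      exact hiM.trans (mul_le_mul_of_nonneg_left hM hB.le)
    refine (Real.log_le_log (by positivity) hle).trans (le_of_eq ?_)
    rw [Real.log_mul (by positivity) (by positivity), Real.log_rpow hn0]
  have e₅ : Real.log (B * A) ≤ 2 * |Real.log (B * A)| * Real.log n := by
    have := le_abs_self (Real.log (B * A))
    nlinarith [abs_nonneg (Real.log (B * A))]
  have e₆ : c * Real.log n ≤ |c| * Real.log n :=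
    mul_le_mul_of_nonneg_right (le_abs_self c) (by linarith)
  rw [e₁]
  linarith

end DynELM

theorem mainTheorem7 (ε ρ : ℝ) (hε : 0 < ε) (hε1 : ε ≤ 1) (hρ : 0 < ρ) (hρ1 : ρ < 1)
    (hρε : (1 + ρ) * ε ≤ 1) (A c : ℝ) :
    ∃ K : ℝ, ∀ (n : ℕ) (ups : List (DynELM.Update n)),
      DynELM.ValidFrom ⊥ ups →
      (ups.length : ℝ) ≤ A * (n : ℝ) ^ c →
      ∀ r ∈ (DynELM.run ε ρ (1 / (n : ℝ)) ups).dist.support,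
        ∃ (st : DynELM.State n) (T : ℕ), r = some (st, T) ∧
          (T : ℝ) ≤ (ups.length : ℝ) * (K * Real.log n ^ 2) := by
  have hκ : 0 < 1 / 2 * ρ * ε := by positivity
  have hκ' : 1 / 2 * ρ * ε ≤ 1 / 2 := by nlinarith
  have hB : 0 < 4 / (1 / 2 * ρ * ε) + 1 := by positivity
  set B := 4 / (1 / 2 * ρ * ε) + 1 with hBdef
  set C := 2 / (1 / 2 * ρ * ε) ^ 2 * (3 + 4 * |Real.log (B * A)| + 2 * |c|) with hC
  have hC0 : 0 ≤ C := by positivity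
  refine ⟨640 + B * (7400 + 58 * (C + 2)), fun n ups hv hM => ?_⟩
  rcases Nat.eq_zero_or_pos ups.length with h0 | hpos
  · obtain rfl := List.length_eq_zero_iff.1 h0
    exact DynELM.Rand.ensures_pure (Q := fun _ T => (T : ℝ) ≤ _) (by simp)
  -- a valid update needs two different vertices
  have hn : 2 ≤ n := by
    obtain ⟨up, ups', rfl⟩ := List.exists_cons_of_length_pos hpos
    have hne : up.endpoints.1 ≠ up.endpoints.2 := by
      have hup := (DynELM.validFrom_cons.1 hv).1
      cases up with
      | insert u w => exact hup.1
      | delete u w => exact SimpleGraph.Adj.ne hup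
    by_contra hlt
    have : Subsingleton (Fin n) := Fin.subsingleton_iff_le_one.2 (by omega)
    exact hne (Subsingleton.elim _ _)
  have hl := DynELM.half_le_log hn
  have hn0 : (0 : ℝ) < n := by exact_mod_cast (by omega : 0 < n)
  have hA : 0 < A := by
    have h1 : (1 : ℝ) ≤ ups.length := by exact_mod_cast hpos
    exact pos_of_mul_pos_left (by linarith) (Real.rpow_nonneg hn0.le c)
  set L := ⌈C * Real.log n⌉₊ with hLdef
  have hL : ∀ i : ℕ, 1 ≤ i → (i : ℝ) ≤ B * ups.length →
      DynELM.sampleSize (1 / 2 * ρ * ε) (DynELM.invocationDelta (1 / (n : ℝ)) i) ≤ L :=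
    fun i hi hiM => by
      refine Nat.ceil_mono ?_
      rw [hC, mul_assoc (2 / (1 / 2 * ρ * ε) ^ 2)]
      exact mul_le_mul_of_nonneg_left
        (DynELM.log_two_div_invocationDelta_le hn hi hA hB hM hiM) (by positivity)
  have hLle : (L : ℝ) ≤ (C + 2) * Real.log n := by
    have := Nat.ceil_lt_add_one (mul_nonneg hC0 (by linarith : 0 ≤ Real.log n))
    rw [← hLdef] at this
    linarith
  have hR := DynELM.relabelCost_le hn hLle
  have hH := DynELM.treeCost_le hn
  refine DynELM.Rand.Ensures.mono (DynELM.ensures_run hκ hκ' hv hL) fun st T hT => hT.trans ?_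
  refine mul_le_mul_of_nonneg_left ?_ (Nat.cast_nonneg _)
  have h₁ := mul_le_mul_of_nonneg_left hR hB.le
  have h₂ : 320 * Real.log n ≤ 640 * Real.log n ^ 2 := by nlinarith
  linarith
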